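/- A Markov automaton (MA) $\mathcal M=(S,A,\to,\Rightarrow,s_0)$ has a finite nonempty state set $S$, a finite action set $A$, a probabilistic transition relation $\to\,\subseteq S\times A\times \mathrm{Dist}(S)$ and a finite Markovian transition relation $\Rightarrow\,\subseteq S\times\mathbb R_{>0}\times S$. All actions are internal and, by maximal progress, have priority over Markovian transitions. Let $PS$ be the set of states with an outgoing probabilistic transition, $MS$ the set of states that have outgoing Markovian transitions but no probabilistic ones, $\mathbf R(s,s')=\sum\{\lambda\mid s\stackrel{\lambda}{\Rightarrow}s'\}$ and $E(s)=\sum_{s'}\mathbf R(s,s')$. Assume that $S=PS\cup MS$ and that for every $s$ and $\alpha$ there is at most one $\mu$ with $s\stackrel{\alpha}{\to}\mu$, written $\mu^s_\alpha$. In $s\in PS$ the MA moves, without delay, according to $\mu^s_\alpha$ for the chosen enabled action $\alpha$; in $s\in MS$ it stays for an exponentially distributed time of rate $E(s)$ and then, independently of that time, moves to $s'$ with probability $\mathbf R(s,s')/E(s)$ (label $\bot$). A policy chooses, measurably and possibly at random, an enabled label on the basis of the whole timed history. Write $\Pr_{s,D}$ for the resulting law on timed paths $\pi$ from $s$, and $\pi@u$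 for the set of states occupied at time $u$. Assume that $\mathcal M$ is non-Zeno (under no stationary deterministic policy is there a nonempty strongly connected set of probabilistic states that is never left) and unichain (under every stationary deterministic policy the induced graph on $S$ is strongly connected). For $G\subseteq S$ put $A_{G,t}(\pi)=\frac1t\int_0^t\mathbf 1[\pi@u\cap G\neq\emptyset]\,du$, $A_G=\lim_{t\to\infty}A_{G,t}$, and $$\mathrm{LRA}^{\min}(s,G)=\inf_D\mathbb E_{s,D}(A_G).$$ Let $\mathsf{mdp}(\mathcal M)$ be the MDP on $S$ with labels $A\cup\{\bot\}$, with $\mathbf P(s,\bot,s')=\mathbf R(s,s')/E(s)$ for $s\in MS$, $\mathbf P(s,\alpha,s')=\mu^s_\alpha(s')$ if $\alpha$ is enabled in $s\in PS$, and $0$ otherwise, and with costs $c_1(s,\bot)=1/E(s)$ if $s\in MS\cap G$, $c_2(s,\bot)=1/E(s)$ if $s\in MS$, and $0$ in all other cases. Put $$\mathcal R(\pi)=\lim_{n\to\infty}\frac{\sum_{i<n}c_1(s_i,\alpha_i)}{\sum_{j<n}c_2(s_j,\alpha_j)},\qquad R^{\min}(s)=\inf_D\mathbb E_{s,D}(\mathcal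 R),$$ where $D$ ranges over the history-dependent randomised policies of $\mathsf{mdp}(\mathcal M)$. In both infima $D$ ranges over the policies for which the limit exists almost surely. **Theorem.** For every $G\subseteq S$ and every $s\in S$: 1. $\mathrm{LRA}^{\min}(s,G)=R^{\min}(s)$. 2. Neither side changes if $D$ ranges over all policies and the limit is replaced by the lower limit, or by the upper limit. 3. Both infima are attained, with almost surely existing limits, by one and the same stationary deterministic policy. 4. The common value is finite and is the optimal value, which is attained, of the linear program in the real variables $k$ and $(x_q)_{q\in S}$: maximise $k$ subject to $x_q\le c_1(q,\sigma)-k\,c_2(q,\sigma)+\sum_{q'\in S}\mathbf P(q,\sigma,q')\,x_{q'}$ for all $q\in S$ and all labels $\sigma$ enabled in $q$. -/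

import Mathlib

open MeasureTheory ProbabilityTheory Filter Topology
open scoped NNReal ENNReal BigOperators

noncomputable section

/-- The label set `Act ∪ {⊥}` is `Option A`, with `none` for `⊥`; it is discrete. -/
instance labelMeasurableSpace {A : Type*} : MeasurableSpace (Option A) := ⊤

instance labelDiscrete {A : Type*} : DiscreteMeasurableSpace (Option A) := ⟨fun _ => trivial⟩

/-! ### Markov decision processes with two cost functions -/

/-- A finite MDP `(S, B, P, init)`: for each state `s` and action `β`, either `P s β` is a
probability distribution (`β` is enabled in `s`) or it is identically zero. -/
structure MDP (S B : Type*) [Fintype S] where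
  P : S → B → S → ℝ≥0
  sum_or_zero : ∀ s β, (∑ s', P s β s') = 1 ∨ ∀ s', P s β s' = 0
  init : S

namespace MDP

variable {S B : Type*} [Fintype S] [Fintype B] [Inhabited B]
  [MeasurableSpace S] [DiscreteMeasurableSpace S] [MeasurableSpace B] [DiscreteMeasurableSpace B]

/-- The actions enabled in a state. -/
def enabled (M : MDP S B) (s : S) : Set B := {β | ∃ s', 0 < M.P s β s'}

open Classical in
/-- The successor distribution (the value for a disabled action is irrelevant). -/
def next (M : MDP S B) (s : S) (β : B) : PMF S :=
  if h : (∑ s', M.P s β s') = 1 then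
    PMF.ofFintype (fun s' => (M.P s β s' : ℝ≥0∞)) (by exact_mod_cast h)
  else PMF.pure s

/-- A path `s₀ β₀ s₁ β₁ …` is a sequence of entries; entry `n + 1` is `(βₙ, sₙ₊₁)` and entry `0`
is `(default, s₀)`, whose first component is a dummy. -/
abbrev Step (S B : Type*) := B × S

abbrev Path (S B : Type*) := ℕ → Step S B

/-- Finite paths `s₀ β₀ … sₙ`. -/
abbrev History (S B : Type*) (n : ℕ) := (i : Finset.Iic n) → Step S B

/-- The last state of a finite path. -/
def History.last {n : ℕ} (h : History S B n) : S := (h ⟨n, Finset.mem_Iic.2 le_rfl⟩).2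

/-- A (history-dependent, randomised) policy. -/
structure Policy (M : MDP S B) where
  choice : (n : ℕ) → History S B n → PMF B
  enabled : ∀ n h β, choice n h β ≠ 0 → β ∈ M.enabled h.last

/-- `d` is a stationary deterministic policy. -/
def IsStationary (M : MDP S B) (d : S → B) : Prop := ∀ s, d s ∈ M.enabled s

/-- The policy that always takes `d s` in state `s`. -/
def stationary (M : MDP S B) (d : S → B) (hd : M.IsStationary d) : M.Policy where
  choice _ h := PMF.pure (d h.last)
  enabled n h β hβ := by
    rw [← PMF.mem_support_iff, PMF.mem_support_pure_iff] at hβ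
    rw [hβ]
    exact hd _

namespace Policy

variable {M : MDP S B} (D : M.Policy)

/-- One step: the action is drawn by the policy, then the successor state by the MDP. -/
def kernel (n : ℕ) : Kernel (History S B n) (Step S B) where
  toFun h := ∑ β, D.choice n h β • (Measure.dirac β).prod (M.next h.last β).toMeasure
  measurable' := Measurable.of_discrete

instance (n : ℕ) : IsMarkovKernel (D.kernel n) where
  isProbabilityMeasure h := by
    refine ⟨?_⟩
    have h1 : ∑ β, D.choice n h β = 1 := by
      rw [← tsum_fintype (L := .unconditional _)]
      exact (D.choice n h).tsum_coe
    simp [kernel, h1]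

/-- The probability measure on infinite paths from `s` under the policy. -/
def pathMeasure (s : S) : Measure (Path S B) :=
  Kernel.traj (X := fun _ => Step S B) D.kernel 0 (fun _ => (default, s))

end Policy

/-- The ratio of the costs accumulated in the first `n` steps of a path. -/
def costRatio (c₁ c₂ : S → B → ℝ≥0) (n : ℕ) (π : Path S B) : ℝ≥0∞ :=
  (∑ i ∈ Finset.range n, (c₁ (π i).2 (π (i + 1)).1 : ℝ≥0∞)) /
    (∑ j ∈ Finset.range n, (c₂ (π j).2 (π (j + 1)).1 : ℝ≥0∞))

namespace Policy

variable {M : MDP S B} (D : M.Policy) (c₁ c₂ : S → B → ℝ≥0) (s : S)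

/-- The long-run ratio is well defined (the limit exists) for almost every path. -/
def RatioExists : Prop :=
  ∀ᵐ π ∂D.pathMeasure s, ∃ r, Tendsto (fun n => costRatio c₁ c₂ n π) atTop (𝓝 r)

/-- The expectation of the long-run ratio `lim (Σ c₁ / Σ c₂)`. -/
def expRatio : ℝ≥0∞ :=
  ∫⁻ π, limUnder atTop (fun n => costRatio c₁ c₂ n π) ∂D.pathMeasure s

/-- The expected long-run ratio with the lower limit. -/
def expRatioInf : ℝ≥0∞ :=
  ∫⁻ π, liminf (fun n => costRatio c₁ c₂ n π) atTop ∂D.pathMeasure s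

/-- The expected long-run ratio with the upper limit. -/
def expRatioSup : ℝ≥0∞ :=
  ∫⁻ π, limsup (fun n => costRatio c₁ c₂ n π) atTop ∂D.pathMeasure s

end Policy

section minimum

variable (M : MDP S B) (c₁ c₂ : S → B → ℝ≥0) (s : S)

/-- The minimal expected long-run ratio over all policies for which the long-run ratio is almost
surely defined. -/
def Rmin : ℝ≥0∞ := ⨅ (D : M.Policy) (_ : D.RatioExists c₁ c₂ s), D.expRatio c₁ c₂ s

/-- The same over all policies, with the lower limit. -/
def RminInf : ℝ≥0∞ := ⨅ D : M.Policy, D.expRatioInf c₁ c₂ s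

/-- The same over all policies, with the upper limit. -/
def RminSup : ℝ≥0∞ := ⨅ D : M.Policy, D.expRatioSup c₁ c₂ s

/-- The constraints of the linear program (with objective: maximise `k`). -/
def LPFeasible (k : ℝ) (x : S → ℝ) : Prop :=
  ∀ s, ∀ β ∈ M.enabled s, x s ≤ c₁ s β - k * c₂ s β + ∑ s', (M.P s β s' : ℝ) * x s'

end minimum

end MDP

/-! ### Markov automata -/

/-- A Markov automaton with finite state space `S` and finite action set `A`:
a probabilistic transition relation, and a (finite) Markovian transition relation with
positive rates. All actions are internal. -/
structure MarkovAutomaton (S A : Type*) where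
  prob : Set (S × A × PMF S)
  markov : Finset (S × ℝ≥0 × S)
  rate_pos : ∀ tr ∈ markov, 0 < tr.2.1
  init : S

namespace MarkovAutomaton

variable {S A : Type*} [Fintype S] [Fintype A]

section basic

variable (M : MarkovAutomaton S A)

/-- Probabilistic states: those with an outgoing probabilistic transition. -/
def PS : Set S := {s | ∃ α μ, (s, α, μ) ∈ M.prob}

/-- Markovian states. By maximal progress, Markovian transitions of a state that also
has a probabilistic (internal) transition are never taken. -/
def MS : Set S := {s | s ∉ M.PS ∧ ∃ r s', (s, r, s') ∈ M.markov}

open Classical in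
/-- The total rate `R(s, s')`. -/
def R (s s' : S) : ℝ≥0 := ∑ tr ∈ M.markov with tr.1 = s ∧ tr.2.2 = s', tr.2.1

/-- The exit rate `E(s)`. -/
def E (s : S) : ℝ≥0 := ∑ s', M.R s s'

theorem E_pos {S A : Type*} [Fintype S] (M : MarkovAutomaton S A) {s : S} (h : s ∈ M.MS) : 0 < M.E s := by
  classical
  obtain ⟨-, r, s', hr⟩ := h
  have h1 : r ≤ M.R s s' := by
    unfold R
    refine Finset.single_le_sum (f := fun tr : S × ℝ≥0 × S => tr.2.1)
      (fun _ _ => zero_le) (a := (s, r, s')) ?_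
    simp [hr]
  have h2 : M.R s s' ≤ M.E s :=
    Finset.single_le_sum (f := fun q => M.R s q) (fun _ _ => zero_le) (Finset.mem_univ s')
  exact (M.rate_pos _ hr).trans_le (h1.trans h2)

/-- The labels enabled in a state: the actions of its probabilistic transitions, and `⊥`
if it is Markovian. -/
def enabled (s : S) : Set (Option A) :=
  {σ | match σ with
    | none => s ∈ M.MS
    | some α => ∃ μ, (s, α, μ) ∈ M.prob}

/-- There is at most one distribution per state and action, so that `μ^s_α` makes sense. -/
def ActionDeterministic : Prop :=
  ∀ s α μ ν, (s, α, μ) ∈ M.prob → (s, α, ν) ∈ M.prob → μ = ν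

/-- Every state has an outgoing transition, i.e. it is probabilistic or Markovian. -/
def DeadlockFree : Prop := ∀ s, s ∈ M.PS ∨ s ∈ M.MS

/-- The distribution `μ^s_α` of an enabled action. -/
def dist (s : S) (α : A) (h : ∃ μ, (s, α, μ) ∈ M.prob) : PMF S := h.choose

open Classical in
/-- The successor distribution of a label: `R(s, ·) / E(s)` for `⊥` and `μ^s_α` for an action `α`
(the value for a disabled label is irrelevant). -/
def next (s : S) : Option A → PMF S
  | none =>
      if h : M.E s ≠ 0 then
        PMF.ofFintype (fun s' => ((M.R s s' / M.E s : ℝ≥0) : ℝ≥0∞)) (by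
          have : ∑ s', M.R s s' / M.E s = 1 := by
            rw [← Finset.sum_div]
            exact div_self h
          exact_mod_cast this)
      else PMF.pure s
  | some α => if h : ∃ μ, (s, α, μ) ∈ M.prob then M.dist s α h else PMF.pure s

open Classical in
/-- The law of the sojourn time: exponential with rate `E(s)` in a Markovian state, `0` in a
probabilistic one. -/
def sojournLaw (s : S) : Measure ℝ≥0 :=
  if s ∈ M.MS then (expMeasure (M.E s)).map Real.toNNReal else Measure.dirac 0

/-- `d` is a stationary deterministic policy (in Markovian states it has no choice but `⊥`). -/
def IsStationary (d : S → Option A) : Prop := ∀ s, d s ∈ M.enabled s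

/-- The edges of the graph induced by a stationary deterministic policy. -/
def Edge (d : S → Option A) (s s' : S) : Prop := M.next s (d s) s' ≠ 0

/-- Unichain: every stationary deterministic policy yields a strongly connected graph. -/
def Unichain : Prop :=
  ∀ d, M.IsStationary d → ∀ s s', Relation.ReflTransGen (M.Edge d) s s'

/-- Non-Zeno: under no stationary deterministic policy is there a strongly connected set
of states that consists of probabilistic states only and that is never left. -/
def NonZeno : Prop :=
  ∀ d, M.IsStationary d → ¬ ∃ C : Set S, C.Nonempty ∧ C ⊆ M.PS ∧
    (∀ s ∈ C, ∀ s', M.Edge d s s' → s' ∈ C) ∧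
    (∀ s ∈ C, ∀ s' ∈ C, Relation.ReflTransGen (M.Edge d) s s')

end basic

/-- A timed path `s₀ (σ₀, t₀) s₁ (σ₁, t₁) …` is a sequence of entries; entry `n + 1` is
`(σₙ, tₙ, sₙ₊₁)`, and entry `0` is `(none, 0, s₀)`, whose first two components are dummies. The
distributions `μₙ` are determined by `sₙ` and `σₙ`. -/
abbrev Step (S A : Type*) := Option A × ℝ≥0 × S

abbrev Path (S A : Type*) := ℕ → Step S A

/-- Finite timed paths `s₀ (σ₀, t₀) … sₙ`. -/
abbrev History (S A : Type*) (n : ℕ) := (i : Finset.Iic n) → Step S A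

/-- The last state of a finite timed path. -/
def History.last {n : ℕ} (h : History S A n) : S := (h ⟨n, Finset.mem_Iic.2 le_rfl⟩).2.2

/-- The `n`-th state of a path. -/
def Path.state (π : Path S A) (n : ℕ) : S := (π n).2.2

/-- The sojourn time in the `n`-th state of a path. -/
def Path.sojourn (π : Path S A) (n : ℕ) : ℝ≥0 := (π (n + 1)).2.1

/-- The time that elapses before the `n`-th state is entered. -/
def Path.elapsed (π : Path S A) (n : ℕ) : ℝ≥0 := ∑ i ∈ Finset.range n, Path.sojourn π i

/-- `π@u`: the set of states that are occupied at time `u`. -/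
def Path.statesAt (π : Path S A) (u : ℝ) : Set S :=
  {q | ∃ n, Path.state π n = q ∧ (Path.elapsed π n : ℝ) ≤ u ∧ u ≤ (Path.elapsed π (n + 1) : ℝ)}

/-- The fraction `A_{G,t}` of time spent in `G` up to time `t`. -/
def timeFraction (G : Set S) (t : ℝ) (π : Path S A) : ℝ≥0∞ :=
  (∫⁻ u in Set.Icc 0 t, {u : ℝ | (G ∩ Path.statesAt π u).Nonempty}.indicator 1 u) /
    ENNReal.ofReal t

variable [MeasurableSpace S] [DiscreteMeasurableSpace S]

theorem measurable_last {S A : Type*} [MeasurableSpace S] (n : ℕ) : Measurable (History.last : History S A n → S) := by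
  unfold History.last
  fun_prop

instance (M : MarkovAutomaton S A) (s : S) : IsProbabilityMeasure (M.sojournLaw s) := by
  unfold sojournLaw
  split_ifs with h
  · have := isProbabilityMeasure_expMeasure (r := M.E s) (by exact_mod_cast M.E_pos h)
    exact Measure.isProbabilityMeasure_map measurable_real_toNNReal.aemeasurable
  · infer_instance

/-- A general measurable policy: on the basis of the whole timed history it selects, at random,
one of the labels that are enabled in the current state. -/
structure Policy (M : MarkovAutomaton S A) where
  choice : (n : ℕ) → History S A n → PMF (Option A)
  measurable : ∀ n σ, Measurable fun h => choice n h σ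
  enabled : ∀ n h σ, choice n h σ ≠ 0 → σ ∈ M.enabled h.last

/-- The policy that always takes `d s` in state `s`. -/
def stationary (M : MarkovAutomaton S A) (d : S → Option A) (hd : M.IsStationary d) :
    M.Policy where
  choice _ h := PMF.pure (d h.last)
  measurable n σ :=
    (Measurable.of_discrete (f := fun s => PMF.pure (d s) σ)).comp (measurable_last n)
  enabled n h σ hσ := by
    rw [← PMF.mem_support_iff, PMF.mem_support_pure_iff] at hσ
    rw [hσ]
    exact hd _

namespace Policy

variable {M : MarkovAutomaton S A} (D : M.Policy)

/-- One step: the label is drawn by the policy, then, independently, the sojourn time in the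
current state and the successor state. -/
def kernel (n : ℕ) : Kernel (History S A n) (Step S A) where
  toFun h := ∑ σ, D.choice n h σ •
    (Measure.dirac σ).prod ((M.sojournLaw h.last).prod (M.next h.last σ).toMeasure)
  measurable' := by
    refine Measure.measurable_of_measurable_coe _ fun s _ => ?_
    simp only [Measure.coe_finsetSum, Finset.sum_apply, Measure.smul_apply, smul_eq_mul]
    refine Finset.measurable_fun_sum _ fun σ _ => (D.measurable n σ).mul ?_
    exact (Measurable.of_discrete (f := fun q => ((Measure.dirac σ).prod
      ((M.sojournLaw q).prod (M.next q σ).toMeasure)) s)).comp (measurable_last n)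

instance (n : ℕ) : IsMarkovKernel (D.kernel n) where
  isProbabilityMeasure h := by
    refine ⟨?_⟩
    have h1 : ∑ σ, D.choice n h σ = 1 := by
      rw [← tsum_fintype (L := .unconditional _)]
      exact (D.choice n h).tsum_coe
    simp only [kernel, Kernel.coe_mk, Measure.coe_finsetSum, Finset.sum_apply,
      Measure.smul_apply, measure_univ, smul_eq_mul, mul_one, h1]

/-- The probability measure `Pr_{s,D}` on infinite timed paths. -/
def pathMeasure (s : S) : Measure (Path S A) :=
  Kernel.traj (X := fun _ => Step S A) D.kernel 0 (fun _ => (none, 0, s))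

variable (s : S) (G : Set S)

/-- The long-run fraction of time in `G` is well defined (the limit exists) for almost every
path. -/
def AverageExists : Prop :=
  ∀ᵐ π ∂D.pathMeasure s, ∃ a, Tendsto (fun t : ℝ => timeFraction G t π) atTop (𝓝 a)

/-- `LRA^D(s, G)`: the expectation of `A_G = lim_{t → ∞} A_{G,t}`. -/
def LRA : ℝ≥0∞ :=
  ∫⁻ π, limUnder atTop (fun t : ℝ => timeFraction G t π) ∂D.pathMeasure s

/-- The long-run average with the lower limit. -/
def LRAInf : ℝ≥0∞ :=
  ∫⁻ π, liminf (fun t : ℝ => timeFraction G t π) atTop ∂D.pathMeasure s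

/-- The long-run average with the upper limit. -/
def LRASup : ℝ≥0∞ :=
  ∫⁻ π, limsup (fun t : ℝ => timeFraction G t π) atTop ∂D.pathMeasure s

end Policy

section minimum

variable (M : MarkovAutomaton S A) (s : S) (G : Set S)

/-- The minimal long-run average time spent in `G`, over all policies for which the long-run
fraction is almost surely defined. -/
def LRAmin : ℝ≥0∞ := ⨅ (D : M.Policy) (_ : D.AverageExists s G), D.LRA s G

/-- The same over all policies, with the lower limit. -/
def LRAminInf : ℝ≥0∞ := ⨅ D : M.Policy, D.LRAInf s G

/-- The same over all policies, with the upper limit. -/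
def LRAminSup : ℝ≥0∞ := ⨅ D : M.Policy, D.LRASup s G

end minimum

/-! ### The two-cost MDP of a Markov automaton -/

section mdp

variable {S A : Type*} [Fintype S] (M : MarkovAutomaton S A)

open Classical in
/-- The transition probabilities of `mdp(M)`. -/
def mdpP (s : S) : Option A → S → ℝ≥0
  | none, s' => if s ∈ M.MS then M.R s s' / M.E s else 0
  | some α, s' => if h : ∃ μ, (s, α, μ) ∈ M.prob then (M.dist s α h s').toNNReal else 0

theorem mdpP_sum (s : S) (σ : Option A) :
    (∑ s', M.mdpP s σ s') = 1 ∨ ∀ s', M.mdpP s σ s' = 0 := by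
  classical
  cases σ with
  | none =>
    by_cases h : s ∈ M.MS
    · left
      simp only [mdpP, h, if_true]
      rw [← Finset.sum_div]
      exact div_self (M.E_pos h).ne'
    · right
      simp [mdpP, h]
  | some α =>
    by_cases h : ∃ μ, (s, α, μ) ∈ M.prob
    · left
      simp only [mdpP, h, dif_pos]
      have h1 : ∑ s', M.dist s α h s' = 1 := by
        rw [← tsum_fintype (L := .unconditional _)]
        exact (M.dist s α h).tsum_coe
      rw [← ENNReal.toNNReal_sum (fun a _ => PMF.apply_ne_top _ _), h1, ENNReal.toNNReal_one]
    · right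
      simp [mdpP, h]

/-- The MDP `mdp(M)`. -/
def mdp : MDP S (Option A) where
  P := M.mdpP
  sum_or_zero := M.mdpP_sum
  init := M.init

open Classical in
/-- The cost `c₁`: the mean sojourn time in Markovian `G`-states, and `0` otherwise. -/
def cost₁ (G : Set S) (s : S) (σ : Option A) : ℝ≥0 :=
  if s ∈ M.MS ∩ G ∧ σ = none then 1 / M.E s else 0

open Classical in
/-- The cost `c₂`: the mean sojourn time in Markovian states, and `0` otherwise. -/
def cost₂ (s : S) (σ : Option A) : ℝ≥0 :=
  if s ∈ M.MS ∧ σ = none then 1 / M.E s else 0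

end mdp

end MarkovAutomaton

end

/-! Policies of the automaton and of its MDP are never translated into each other: both sides are
compared with one number `k`, by bounds that hold on almost every path.

Under a stationary deterministic policy `d` the chain is irreducible, so the Poisson equation x = c₁
- k c₂ + P x has a solution. Among the finitely many such policies take one of least gain `k`. If
its potential violated the linear program at some label, switching to that label would contradict
the minimum principle (`eq_of_superharmonic`). Hence `(k, x)` is feasible, with equality along `d`,
and the same principle shows that no feasible point has a larger gain
(`MDP.exists_optimality_equation`).

Along any policy, the differences between x at the next state and its conditional mean are bounded
martingale differences. The strong law (`ae_tendsto_traj_sum_div`) and telescoping turn feasibility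
into Σ c₁ - k Σ c₂ ≥ -o(n), and equality along `d` gives the reverse bound. Non-Zenoness yields a
second potential, with gain ε > 0 for the cost c₂ per step (`MDP.exists_pos_potential`), so Σ c₂
grows linearly and one may divide: the lower limit of the ratio is at least `k` for every policy,
and the limit is `k` under `d`.

In the automaton, sojourn times minus their means are centred and square integrable given the state,
so the same strong law replaces accumulated costs by elapsed and occupation times. Single sojourns
are o(n), which extends the estimate from jump times to all times. Since the bounds are pathwise,
they apply alike to limits, lower limits and upper limits. -/

noncomputable section

/-! ### Irreducible finite chains: minimum principle and Poisson equation. -/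

/-- Minimum principle: a superharmonic function of an irreducible finite chain is constant. -/
theorem eq_of_superharmonic {S : Type*} [Fintype S] {P : S → S → ℝ≥0}
    (hsum : ∀ s, ∑ s', P s s' = 1)
    (hconn : ∀ s s', Relation.ReflTransGen (fun a b => 0 < P a b) s s') {z : S → ℝ}
    (hz : ∀ s, ∑ s', (P s s' : ℝ) * z s' ≤ z s) (a b : S) : z a = z b := by
  have : Nonempty S := ⟨a⟩
  obtain ⟨m, hm⟩ := Finite.exists_min z
  suffices h : ∀ s, z s = z m by rw [h a, h b]
  intro s
  induction hconn m s with
  | refl => rfl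
  | @tail s s' _ hP ih =>
    have hsum' : ∑ q, (P s q : ℝ) = 1 := by exact_mod_cast hsum s
    have h0 : ∑ q, (P s q : ℝ) * (z q - z m) ≤ 0 := by
      have : ∑ q, (P s q : ℝ) * (z q - z m) = ∑ q, (P s q : ℝ) * z q - z m := by
        simp only [mul_sub, Finset.sum_sub_distrib, ← Finset.sum_mul, hsum', one_mul]
      linarith [hz s]
    have hnn : ∀ q ∈ Finset.univ, 0 ≤ (P s q : ℝ) * (z q - z m) := fun q _ =>
      mul_nonneg (P s q).coe_nonneg (sub_nonneg.2 (hm q))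
    have h1 := (Finset.sum_eq_zero_iff_of_nonneg hnn).1
      (le_antisymm h0 (Finset.sum_nonneg hnn)) s' (Finset.mem_univ _)
    have hP' : (P s s' : ℝ) ≠ 0 := by exact_mod_cast hP.ne'
    have := (mul_eq_zero.1 h1).resolve_left hP'
    linarith

/-- The Poisson equation of an irreducible finite chain with gain weighted by `c`. -/
theorem exists_poisson_solution {S : Type*} [Fintype S] {P : S → S → ℝ≥0}
    (hsum : ∀ s, ∑ s', P s s' = 1)
    (hconn : ∀ s s', Relation.ReflTransGen (fun a b => 0 < P a b) s s') {c : S → ℝ≥0}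
    (hc : ∃ s, 0 < c s) (r : S → ℝ) :
    ∃ (k : ℝ) (x : S → ℝ), ∀ s, x s = r s - k * c s + ∑ s', (P s s' : ℝ) * x s' := by
  obtain ⟨s₀, hs₀⟩ := hc
  -- The potential is determined only up to a constant; the extra coordinate `x s₀` fixes it and
  -- makes the system square, so injectivity suffices.
  let T : (ℝ × (S → ℝ)) →ₗ[ℝ] (ℝ × (S → ℝ)) :=
    { toFun := fun p => (p.2 s₀, fun s => p.2 s + p.1 * c s - ∑ s', (P s s' : ℝ) * p.2 s')
      map_add' := fun p q => by
        refine Prod.ext (by simp) (funext fun s => ?_)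
        simp only [Prod.fst_add, Prod.snd_add, Pi.add_apply, mul_add, Finset.sum_add_distrib]
        ring
      map_smul' := fun a p => by
        refine Prod.ext (by simp) (funext fun s => ?_)
        simp only [Prod.smul_fst, Prod.smul_snd, Pi.smul_apply, smul_eq_mul, RingHom.id_apply,
          mul_sub, mul_add, Finset.mul_sum]
        congr 1
        · ring
        · exact Finset.sum_congr rfl fun _ _ => by ring }
  have hinj : Function.Injective T := by
    rw [← LinearMap.ker_eq_bot, LinearMap.ker_eq_bot']
    rintro ⟨k, x⟩ h
    have h1 : x s₀ = 0 := congrArg Prod.fst h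
    have h2 : ∀ s, x s + k * c s - ∑ s', (P s s' : ℝ) * x s' = 0 := fun s =>
      congrFun (congrArg Prod.snd h) s
    have hconst : ∀ s, x s = 0 := by
      intro s
      rw [← h1]
      -- On the kernel x - P x = -k c has one sign, so x or -x is superharmonic, hence constant;
      -- then k c = 0, and `c s₀ > 0` gives k = 0.
      rcases le_total k 0 with hk | hk
      · refine eq_of_superharmonic hsum hconn (fun q => ?_) s s₀
        have := mul_nonpos_iff.2 (.inr ⟨hk, (c q).coe_nonneg⟩)
        linarith [h2 q]
      · have := eq_of_superharmonic hsum hconn (z := fun q => - x q) (fun q => ?_) s s₀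
        · linarith
        · have := mul_nonneg hk (c q).coe_nonneg
          simp only [mul_neg, Finset.sum_neg_distrib]
          linarith [h2 q]
    have hk : k * c s₀ = 0 := by simpa [hconst] using h2 s₀
    have hk : k = 0 := (mul_eq_zero.1 hk).resolve_right (by exact_mod_cast hs₀.ne')
    exact Prod.ext hk (funext hconst)
  obtain ⟨⟨k, x⟩, h⟩ := (LinearMap.injective_iff_surjective.1 hinj) (0, r)
  refine ⟨k, x, fun s => ?_⟩
  have : x s + k * c s - ∑ s', (P s s' : ℝ) * x s' = r s := congrFun (congrArg Prod.snd h) s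
  linarith

/-! ### The optimality equation and its linear program. -/

namespace MDP

variable {S B : Type*} [Fintype S] {M : MDP S B}

theorem sum_eq_one_of_mem_enabled {s : S} {β : B} (h : β ∈ M.enabled s) :
    ∑ s', M.P s β s' = 1 := by
  obtain ⟨s', hs'⟩ := h
  exact (M.sum_or_zero s β).resolve_right fun h0 => hs'.ne' (h0 s')

/-- Every stationary deterministic policy induces a strongly connected graph. -/
def IsUnichain (M : MDP S B) : Prop :=
  ∀ d, M.IsStationary d → ∀ s s', Relation.ReflTransGen (fun a b => 0 < M.P a (d a) b) s s'

/-- In a unichain MDP whose stationary policies all incur `c₂`-cost somewhere, the optimality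
equation has a solution, and its gain is the optimal value of the linear program. -/
theorem exists_optimality_equation [Finite B] (hen : ∀ s, (M.enabled s).Nonempty)
    (huni : M.IsUnichain) (c₁ c₂ : S → B → ℝ≥0)
    (hc : ∀ d, M.IsStationary d → ∃ s, 0 < c₂ s (d s)) :
    ∃ (k : ℝ) (x : S → ℝ) (d : S → B), M.IsStationary d ∧ M.LPFeasible c₁ c₂ k x ∧
      (∀ s, x s = c₁ s (d s) - k * c₂ s (d s) + ∑ s', (M.P s (d s) s' : ℝ) * x s') ∧
      ∀ k' x', M.LPFeasible c₁ c₂ k' x' → k' ≤ k := by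
  classical
  have hsol : ∀ d : {d : S → B // M.IsStationary d}, ∃ (k : ℝ) (x : S → ℝ), ∀ s,
      x s = c₁ s (d.1 s) - k * c₂ s (d.1 s) + ∑ s', (M.P s (d.1 s) s' : ℝ) * x s' := fun d =>
    exists_poisson_solution (P := fun s s' => M.P s (d.1 s) s')
      (fun s => sum_eq_one_of_mem_enabled (d.2 s)) (huni d.1 d.2)
      (c := fun s => c₂ s (d.1 s)) (hc d.1 d.2) fun s => c₁ s (d.1 s)
  choose K X hX using hsol
  have : Nonempty {d : S → B // M.IsStationary d} :=
    ⟨⟨fun s => (hen s).choose, fun s => (hen s).choose_spec⟩⟩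
  -- A function that satisfies the equation of `e` up to a nonnegative excess, for a smaller gain,
  -- has no excess at all.
  have key : ∀ (e : S → B) (_ : M.IsStationary e) (z : S → ℝ) (a : ℝ), 0 ≤ a →
      (∀ s, a * c₂ s (e s) + ∑ s', (M.P s (e s) s' : ℝ) * z s' ≤ z s) →
      ∀ s, z s = a * c₂ s (e s) + ∑ s', (M.P s (e s) s' : ℝ) * z s' ∧ a * c₂ s (e s) = 0 := by
    intro e he z a ha hz s
    have hs1 := fun s => sum_eq_one_of_mem_enabled (he s)
    -- `z` is superharmonic, hence constant and equal to its own average, which leaves no room for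
    -- the excess.
    have hcst := eq_of_superharmonic (P := fun s s' => M.P s (e s) s') hs1 (huni e he) (z := z)
      fun s => by have := mul_nonneg ha (c₂ s (e s)).coe_nonneg; linarith [hz s]
    have hsum : ∑ s', (M.P s (e s) s' : ℝ) * z s' = z s := by
      rw [Finset.sum_congr rfl fun s' _ => by rw [hcst s' s], ← Finset.sum_mul,
        show ∑ s', (M.P s (e s) s' : ℝ) = 1 by exact_mod_cast hs1 s, one_mul]
    have := mul_nonneg ha (c₂ s (e s)).coe_nonneg
    have := hz s
    constructor <;> linarith
  obtain ⟨⟨d, hd⟩, hmin⟩ := Finite.exists_min K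
  refine ⟨K ⟨d, hd⟩, X ⟨d, hd⟩, d, hd, ?_, hX ⟨d, hd⟩, ?_⟩
  · intro q β hβ
    by_contra! hlt
    -- Policy improvement: switch to the violating label at `q` only. The difference of the
    -- potentials of `d` and of the new policy then satisfies `key`, whose equality at `q`
    -- contradicts the strict violation.
    have he : M.IsStationary (Function.update d q β) := by
      intro s
      by_cases hs : s = q
      · subst hs; simpa using hβ
      · simpa [hs] using hd s
    set e := Function.update d q β with he_def
    have hge : ∀ s, c₁ s (e s) - K ⟨d, hd⟩ * c₂ s (e s) +
        ∑ s', (M.P s (e s) s' : ℝ) * X ⟨d, hd⟩ s' ≤ X ⟨d, hd⟩ s := by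
      intro s
      by_cases hs : s = q
      · subst hs; simpa [he_def] using hlt.le
      · simpa [he_def, hs] using (hX ⟨d, hd⟩ s).ge
    have hk : 0 ≤ K ⟨e, he⟩ - K ⟨d, hd⟩ := sub_nonneg.2 (hmin _)
    have := (key e he (fun s => X ⟨d, hd⟩ s - X ⟨e, he⟩ s) _ hk (fun s => ?_) q).1
    · have h2 := hX ⟨e, he⟩ q
      simp only [he_def, Function.update_self, mul_sub, Finset.sum_sub_distrib] at this h2 hlt
      linarith
    · have h2 := hX ⟨e, he⟩ s
      have h3 := hge s
      simp only [mul_sub, Finset.sum_sub_distrib] at h2 ⊢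
      linarith
  · intro k' x' hx'
    by_contra! hlt
    obtain ⟨q, hq⟩ := hc d hd
    have := (key d hd (fun s => X ⟨d, hd⟩ s - x' s) (k' - K ⟨d, hd⟩) (sub_nonneg.2 hlt.le)
      (fun s => ?_) q).2
    · have hq' : (0 : ℝ) < c₂ q (d q) := by exact_mod_cast hq
      have := mul_pos (sub_pos.2 hlt) hq'
      linarith
    · have h2 := hX ⟨d, hd⟩ s
      have h3 := hx' s (d s) (hd s)
      simp only [mul_sub, Finset.sum_sub_distrib] at h2 ⊢
      linarith

/-- A potential witnessing that every policy incurs `c₂`-cost at a positive rate. -/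
theorem exists_pos_potential [Finite B] (hen : ∀ s, (M.enabled s).Nonempty)
    (huni : M.IsUnichain) (c : S → B → ℝ≥0)
    (hc : ∀ d, M.IsStationary d → ∃ s, 0 < c s (d s)) :
    ∃ ε > 0, ∃ y, M.LPFeasible c (fun _ _ => 1) ε y := by
  -- With second cost 1 the gain is a minimal cost per step. Were it nonpositive, the potential of
  -- `d` would be superharmonic, hence constant, forcing `c` to be nonpositive along `d`.
  obtain ⟨k, x, d, hd, hf, heq, -⟩ := exists_optimality_equation hen huni c (fun _ _ => 1)
    fun d hd => (hc d hd).imp fun _ _ => one_pos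
  refine ⟨k, ?_, x, hf⟩
  by_contra! hk
  obtain ⟨q, hq⟩ := hc d hd
  have hs1 := fun s => sum_eq_one_of_mem_enabled (hd s)
  simp only [NNReal.coe_one, mul_one] at heq
  have hcst := eq_of_superharmonic (P := fun s s' => M.P s (d s) s') hs1 (huni d hd) (z := x)
    fun s => by have := (c s (d s)).coe_nonneg; linarith [heq s]
  have hsum : ∑ s', (M.P q (d q) s' : ℝ) * x s' = x q := by
    rw [Finset.sum_congr rfl fun s' _ => by rw [hcst s' q], ← Finset.sum_mul,
      show ∑ s', (M.P q (d q) s' : ℝ) = 1 by exact_mod_cast hs1 q, one_mul]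
  have hq' : (0 : ℝ) < c q (d q) := by exact_mod_cast hq
  linarith [heq q]

end MDP

/-! ### Strong law of large numbers for martingale differences. -/

/-- Kronecker's lemma for the weights `1, 2, 3, …`. -/
theorem tendsto_sum_div_of_tendsto_sum_div_succ {a : ℕ → ℝ} {l : ℝ}
    (h : Tendsto (fun n => ∑ i ∈ Finset.range n, a i / (i + 1)) atTop (𝓝 l)) :
    Tendsto (fun n : ℕ => (∑ i ∈ Finset.range n, a i) / n) atTop (𝓝 0) := by
  set T : ℕ → ℝ := fun n => ∑ i ∈ Finset.range n, a i / (i + 1) with hT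
  -- Summation by parts: the averages of `a` are `T n` minus the Cesàro mean of `T`, and both tend
  -- to `l`.
  have hsum : ∀ n, ∑ i ∈ Finset.range n, a i = n * T n - ∑ i ∈ Finset.range n, T i := by
    intro n
    induction n with
    | zero => simp
    | succ n ih =>
      have h1 : T (n + 1) = T n + a n / (n + 1) := Finset.sum_range_succ _ _
      have h2 : (n + 1 : ℝ) ≠ 0 := by positivity
      rw [Finset.sum_range_succ, Finset.sum_range_succ, ih, h1]
      push_cast
      field_simp
      ring
  have h1 : Tendsto (fun n : ℕ => T n - (n : ℝ)⁻¹ * ∑ i ∈ Finset.range n, T i) atTop (𝓝 0) := by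
    simpa using h.sub h.cesaro
  refine h1.congr' ?_
  filter_upwards [eventually_ne_atTop 0] with n hn
  have : (n : ℝ) ≠ 0 := by exact_mod_cast hn
  rw [hsum]
  field_simp

/-- Strong law of large numbers for martingale differences bounded in `L²`. -/
theorem ae_tendsto_sum_div_of_condExp_eq_zero {Ω : Type*} {m0 : MeasurableSpace Ω}
    {μ : Measure Ω} [IsProbabilityMeasure μ] {𝒢 : Filtration ℕ m0} {ξ : ℕ → Ω → ℝ}
    (hadp : ∀ n, StronglyMeasurable[𝒢 (n + 1)] (ξ n)) (hL : ∀ n, MemLp (ξ n) 2 μ) {C : ℝ}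
    (hC : ∀ n, ∫ ω, ξ n ω ^ 2 ∂μ ≤ C) (h0 : ∀ n, μ[ξ n | 𝒢 n] =ᵐ[μ] 0) :
    ∀ᵐ ω ∂μ, Tendsto (fun n : ℕ => (∑ i ∈ Finset.range n, ξ i ω) / n) atTop (𝓝 0) := by
  -- The weights 1/(i+1) are square summable, so this martingale is bounded in L² and converges;
  -- Kronecker's lemma then gives the averages. `ξ n` is known at time n + 1, so `m n` is known at
  -- time n.
  let m : ℕ → Ω → ℝ := fun n => ∑ i ∈ Finset.range n, ((i : ℝ) + 1)⁻¹ • ξ i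
  have hsucc : ∀ n, m (n + 1) = m n + ((n : ℝ) + 1)⁻¹ • ξ n := fun n =>
    Finset.sum_range_succ _ _
  have hmeas : StronglyAdapted 𝒢 m := fun n =>
    Finset.stronglyMeasurable_sum _ fun i hi =>
      ((hadp i).mono (𝒢.mono (Finset.mem_range.1 hi))).const_smul _
  have hmL : ∀ n, MemLp (m n) 2 μ := fun n =>
    memLp_finsetSum' _ fun i _ => (hL i).const_smul _
  have hmart : Martingale m 𝒢 μ := by
    refine martingale_of_condExp_sub_eq_zero_nat hmeas
      (fun n => (hmL n).integrable one_le_two) fun n => ?_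
    rw [hsucc, add_sub_cancel_left]
    filter_upwards [condExp_smul ((n : ℝ) + 1)⁻¹ (ξ n) (𝒢 n), h0 n] with ω h1 h2
    rw [h1, Pi.smul_apply, h2, Pi.zero_apply, smul_zero]
  have hC0 : 0 ≤ C := (integral_nonneg fun ω => sq_nonneg (ξ 0 ω)).trans (hC 0)
  have hsq : ∀ n, ∫ ω, m n ω ^ 2 ∂μ ≤ C * ∑ i ∈ Finset.range n, (((i : ℝ) + 1) ^ 2)⁻¹ := by
    intro n
    induction n with
    | zero => simp [m]
    | succ n ih =>
      have hprod : Integrable (m n * ξ n) μ := (hmL n).integrable_mul (hL n)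
      have hi₁ : Integrable (fun ω => 2 * ((n : ℝ) + 1)⁻¹ * (m n ω * ξ n ω)) μ :=
        hprod.const_mul _
      have hi₂ : Integrable (fun ω => (((n : ℝ) + 1) ^ 2)⁻¹ * ξ n ω ^ 2) μ :=
        (hL n).integrable_sq.const_mul _
      have horth : ∫ ω, m n ω * ξ n ω ∂μ = 0 := by
        have h1 := condExp_mul_of_stronglyMeasurable_left (hmeas n) hprod
          ((hL n).integrable one_le_two)
        calc ∫ ω, m n ω * ξ n ω ∂μ = ∫ ω, (μ[m n * ξ n | 𝒢 n]) ω ∂μ :=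
              (integral_condExp (𝒢.le n)).symm
          _ = ∫ ω, (0 : ℝ) ∂μ := by
              refine integral_congr_ae ?_
              filter_upwards [h1, h0 n] with ω h1 h2
              rw [h1, Pi.mul_apply, h2, Pi.zero_apply, mul_zero]
          _ = 0 := by simp
      have hexp : ∀ ω, m (n + 1) ω ^ 2 = m n ω ^ 2 +
          (2 * ((n : ℝ) + 1)⁻¹ * (m n ω * ξ n ω) + (((n : ℝ) + 1) ^ 2)⁻¹ * ξ n ω ^ 2) := by
        intro ω
        rw [hsucc]
        simp only [Pi.add_apply, Pi.smul_apply, smul_eq_mul]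
        field_simp
        ring
      simp only [hexp]
      rw [integral_add (hmL n).integrable_sq (hi₁.add hi₂ : Integrable (fun ω => _ + _) μ),
        integral_add hi₁ hi₂, integral_const_mul, integral_const_mul, horth, mul_zero, zero_add,
        Finset.sum_range_succ, mul_add]
      refine add_le_add ih ?_
      rw [mul_comm C]
      exact mul_le_mul_of_nonneg_left (hC n) (by positivity)
  have hsummable : Summable fun i : ℕ => (((i : ℝ) + 1) ^ 2)⁻¹ := by
    have := (summable_nat_add_iff 1).2 (Real.summable_nat_pow_inv.2 one_lt_two)
    exact_mod_cast this
  set K : ℝ := C * ∑' i : ℕ, (((i : ℝ) + 1) ^ 2)⁻¹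
  have hK : ∀ n, ∫ ω, m n ω ^ 2 ∂μ ≤ K := fun n => (hsq n).trans
    (mul_le_mul_of_nonneg_left (hsummable.sum_le_tsum _ fun i _ => by positivity) hC0)
  -- The convergence theorem asks for an L¹ bound, and |m| ≤ 1 + m² supplies it.
  have hbdd : ∀ n, eLpNorm (m n) 1 μ ≤ ((1 + K).toNNReal : ℝ≥0∞) := by
    intro n
    rw [eLpNorm_one_eq_lintegral_enorm]
    calc ∫⁻ ω, ‖m n ω‖ₑ ∂μ ≤ ∫⁻ ω, ENNReal.ofReal (1 + m n ω ^ 2) ∂μ := by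
          refine lintegral_mono fun ω => ?_
          rw [Real.enorm_eq_ofReal_abs]
          refine ENNReal.ofReal_le_ofReal ?_
          nlinarith [sq_nonneg (|m n ω| - 1), sq_abs (m n ω)]
      _ = ENNReal.ofReal (∫ ω, (1 + m n ω ^ 2) ∂μ) :=
          (ofReal_integral_eq_lintegral_ofReal ((integrable_const _).add (hmL n).integrable_sq)
            (ae_of_all _ fun ω => add_nonneg zero_le_one (sq_nonneg (m n ω)))).symm
      _ ≤ ENNReal.ofReal (1 + K) := by
          refine ENNReal.ofReal_le_ofReal ?_
          rw [integral_add (integrable_const _) (hmL n).integrable_sq]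
          simpa using hK n
  filter_upwards [hmart.submartingale.exists_ae_tendsto_of_bdd hbdd] with ω ⟨l, hl⟩
  refine tendsto_sum_div_of_tendsto_sum_div_succ (l := l) (hl.congr fun n => ?_)
  simp only [m, Finset.sum_apply, Pi.smul_apply, smul_eq_mul]
  exact Finset.sum_congr rfl fun i _ => by rw [div_eq_inv_mul]

/-! ### Law of large numbers along controlled trajectories. -/

section traj

variable {X S L : Type*} [MeasurableSpace X] [Fintype S] [Fintype L]
  [MeasurableSpace S] [DiscreteMeasurableSpace S]
  {κ : (n : ℕ) → Kernel ((i : Finset.Iic n) → X) X} [∀ n, IsMarkovKernel (κ n)]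
  {state : X → S} {ρ : S → L → Measure X}
  {w : (n : ℕ) → ((i : Finset.Iic n) → X) → L → ℝ≥0∞}

/-- The last entry of a finite sequence. -/
abbrev lastEntry {X : Type*} {n : ℕ} (h : (i : Finset.Iic n) → X) : X :=
  h ⟨n, Finset.mem_Iic.2 le_rfl⟩

theorem measurable_lastEntry {X : Type*} [MeasurableSpace X] (n : ℕ) :
    Measurable (lastEntry : ((i : Finset.Iic n) → X) → X) :=
  measurable_pi_apply _

/-- A property of transitions that holds almost surely for every positively weighted label holds
along almost every trajectory. -/
theorem ae_traj_transition (hκ : ∀ n h, κ n h = ∑ σ, w n h σ • ρ (state (lastEntry h)) σ)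
    (hstate : Measurable state) {p : S → X → Prop} (hp : ∀ s, MeasurableSet {y | p s y})
    (h : ∀ n h σ, w n h σ ≠ 0 → ∀ᵐ y ∂ρ (state (lastEntry h)) σ, p (state (lastEntry h)) y)
    (x₀ : (i : Finset.Iic 0) → X) :
    ∀ᵐ π ∂Kernel.traj (X := fun _ => X) κ 0 x₀, ∀ n, p (state (π n)) (π (n + 1)) := by
  refine ae_all_iff.2 fun n => ?_
  have hset : MeasurableSet {q : ((i : Finset.Iic n) → X) × X | p (state (lastEntry q.1)) q.2} := by
    have h1 : MeasurableSet {q : S × X | p q.1 q.2} := by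
      have : {q : S × X | p q.1 q.2} = ⋃ s, {s} ×ˢ {y | p s y} := by ext ⟨s, y⟩; simp
      rw [this]
      exact MeasurableSet.iUnion fun s => (MeasurableSet.of_discrete).prod (hp s)
    exact h1.preimage (f := fun q : ((i : Finset.Iic n) → X) × X => (state (lastEntry q.1), q.2))
      ((hstate.comp ((measurable_lastEntry n).comp measurable_fst)).prodMk measurable_snd)
  -- The joint law of the history up to n and the next entry is a composition product, so it
  -- suffices to check each label with positive weight.
  have h2 : ∀ᵐ q ∂((Kernel.traj (X := fun _ => X) κ 0 x₀).map
      fun π => (Preorder.frestrictLe n π, π (n + 1))), p (state (lastEntry q.1)) q.2 := by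
    rw [← Kernel.partialTraj_compProd_eq_map_traj (Nat.zero_le n)]
    refine Measure.ae_compProd_of_ae_ae hset (ae_of_all _ fun h' => ?_)
    rw [hκ]
    rw [ae_iff]
    simp only [Measure.coe_finsetSum, Finset.sum_apply, Measure.smul_apply, smul_eq_mul]
    refine Finset.sum_eq_zero fun σ _ => ?_
    by_cases hw : w n h' σ = 0
    · simp [hw]
    · rw [ae_iff.1 (h n h' σ hw), mul_zero]
  exact ae_of_ae_map (by fun_prop) h2

/-- Strong law of large numbers along the trajectories of a controlled chain with finitely many
states and labels, for transition functions that are centred under each label. -/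
theorem ae_tendsto_traj_sum_div [∀ s σ, IsProbabilityMeasure (ρ s σ)]
    (hκ : ∀ n h, κ n h = ∑ σ, w n h σ • ρ (state (lastEntry h)) σ)
    (hstate : Measurable state) {f : S → X → ℝ} (hf : ∀ s, Measurable (f s))
    (hL : ∀ s σ, MemLp (f s) 2 (ρ s σ)) (h0 : ∀ s σ, ∫ y, f s y ∂ρ s σ = 0)
    (x₀ : (i : Finset.Iic 0) → X) :
    ∀ᵐ π ∂Kernel.traj (X := fun _ => X) κ 0 x₀,
      Tendsto (fun n : ℕ => (∑ i ∈ Finset.range n, f (state (π i)) (π (i + 1))) / n)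
        atTop (𝓝 0) := by
  have hw : ∀ n h σ, w n h σ ≤ 1 := by
    intro n h σ
    have h1 : κ n h Set.univ = 1 := measure_univ
    rw [hκ] at h1
    simp only [Measure.coe_finsetSum, Finset.sum_apply, Measure.smul_apply, smul_eq_mul,
      measure_univ, mul_one] at h1
    exact h1 ▸ Finset.single_le_sum (f := w n h) (fun _ _ => zero_le) (Finset.mem_univ σ)
  have hfu : Measurable fun q : S × X => f q.1 q.2 := measurable_from_prod_countable_right hf
  set ξ : ℕ → (ℕ → X) → ℝ := fun n π => f (state (π n)) (π (n + 1)) with hξ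
  have hadp : ∀ n, StronglyMeasurable[Filtration.piLE (X := fun _ : ℕ => X) (n + 1)] (ξ n) := by
    intro n
    refine Measurable.stronglyMeasurable ?_
    rw [Filtration.piLE_eq_comap_frestrictLe]
    have : ξ n = (fun h : (i : Finset.Iic (n + 1)) → X =>
        f (state (h ⟨n, Finset.mem_Iic.2 n.le_succ⟩)) (lastEntry h)) ∘
        Preorder.frestrictLe (n + 1) := rfl
    rw [this]
    exact Measurable.comp (hfu.comp
      ((hstate.comp (measurable_pi_apply _)).prodMk (measurable_lastEntry (n + 1))))
      (comap_measurable _)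
  have hmeas : ∀ n, Measurable (ξ n) := fun n =>
    ((hadp n).mono (Filtration.piLE.le _)).measurable
  -- Summing over the finitely many states and labels bounds the second moment uniformly in the
  -- history; the weights are at most 1.
  set C : ℝ≥0∞ := ∑ s, ∑ σ, ∫⁻ y, ‖f s y ^ 2‖ₑ ∂ρ s σ with hCdef
  have hCtop : C ≠ ⊤ := ENNReal.sum_ne_top.2 fun s _ => ENNReal.sum_ne_top.2 fun σ _ =>
    (hL s σ).integrable_sq.2.ne
  have hbound : ∀ n, ∫⁻ π, ‖ξ n π ^ 2‖ₑ ∂Kernel.traj (X := fun _ => X) κ 0 x₀ ≤ C := by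
    intro n
    have hg : Measurable fun q : ((i : Finset.Iic n) → X) × X =>
        ‖f (state (lastEntry q.1)) q.2 ^ 2‖ₑ :=
      ((hfu.comp (g := fun q : S × X => f q.1 q.2)
        (f := fun q : ((i : Finset.Iic n) → X) × X => (state (lastEntry q.1), q.2))
        ((hstate.comp ((measurable_lastEntry n).comp measurable_fst)).prodMk
          measurable_snd)).pow_const 2).enorm
    have h1 : ∫⁻ π, ‖ξ n π ^ 2‖ₑ ∂Kernel.traj (X := fun _ => X) κ 0 x₀ =
        ∫⁻ q, ‖f (state (lastEntry q.1)) q.2 ^ 2‖ₑ ∂((Kernel.traj (X := fun _ => X) κ 0 x₀).map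
          fun π => (Preorder.frestrictLe n π, π (n + 1))) := by
      rw [lintegral_map hg (by fun_prop)]
      rfl
    rw [h1, ← Kernel.partialTraj_compProd_eq_map_traj (Nat.zero_le n),
      Measure.lintegral_compProd hg]
    calc _ ≤ ∫⁻ _, C ∂Kernel.partialTraj (X := fun _ => X) κ 0 n x₀ := by
          refine lintegral_mono fun h => ?_
          simp only [hκ, lintegral_finsetSum_measure, lintegral_smul_measure]
          refine (Finset.sum_le_sum fun σ _ => ?_).trans (Finset.single_le_sum
            (f := fun s => ∑ σ, ∫⁻ y, ‖f s y ^ 2‖ₑ ∂ρ s σ) (fun _ _ => zero_le)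
            (Finset.mem_univ (state (lastEntry h))))
          exact mul_le_of_le_one_left zero_le (hw n h σ)
      _ = C := by simp
  have hint : ∀ n, Integrable (fun π => ξ n π ^ 2) (Kernel.traj (X := fun _ => X) κ 0 x₀) :=
    fun n => ⟨((hmeas n).pow_const 2).aestronglyMeasurable, (hbound n).trans_lt hCtop.lt_top⟩
  have hmem : ∀ n, MemLp (ξ n) 2 (Kernel.traj (X := fun _ => X) κ 0 x₀) := fun n =>
    (memLp_two_iff_integrable_sq (hmeas n).aestronglyMeasurable).2 (hint n)
  refine ae_tendsto_sum_div_of_condExp_eq_zero hadp hmem (C := C.toReal) (fun n => ?_)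
    fun n => ?_
  · rw [integral_eq_lintegral_of_nonneg_ae (ae_of_all _ fun π => sq_nonneg _)
      ((hmeas n).pow_const 2).aestronglyMeasurable]
    refine ENNReal.toReal_mono hCtop ((lintegral_mono fun π => ?_).trans (hbound n))
    exact Real.ofReal_le_enorm _
  -- Given the history, the next entry follows a mixture of the laws `ρ`. Each of them centres `f`,
  -- so the policy's choice of weights is immaterial.
  · filter_upwards [Kernel.condExp_traj (Nat.zero_le n)
      ((hmem n).integrable one_le_two)] with π hπ
    rw [hπ, Kernel.integral_traj _ (hmeas n).aestronglyMeasurable]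
    set h := Preorder.frestrictLe (π := fun _ => X) n π
    have h1 : ∀ y : ℕ → X, ξ n (Function.updateFinset y (Finset.Iic n) h) =
        f (state (lastEntry h)) (y (n + 1)) := by
      intro y
      simp [hξ, Function.updateFinset]
    simp only [h1]
    have h2 : ∫ y, f (state (lastEntry h)) (y (n + 1)) ∂Kernel.traj (X := fun _ => X) κ n h =
        ∫ z, f (state (lastEntry h)) z ∂κ n h := by
      have := Kernel.map_traj_succ_self (X := fun _ => X) (κ := κ) (a := n)
      conv_rhs => rw [← this]
      rw [Kernel.map_apply _ (measurable_pi_apply (n + 1)),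
        integral_map (measurable_pi_apply (n + 1)).aemeasurable (hf _).aestronglyMeasurable]
    have hi : ∀ σ ∈ Finset.univ,
        Integrable (f (state (lastEntry h))) (w n h σ • ρ (state (lastEntry h)) σ) := fun σ _ =>
      ((hL _ σ).integrable one_le_two).smul_measure ((hw n h σ).trans_lt ENNReal.one_lt_top).ne
    rw [h2, hκ, integral_finsetSum_measure hi]
    simp [integral_smul_measure, h0]

end traj

/-! ### Sequences whose averages have a sign in the limit -/

/-- The lower limit of `u n / n` is nonnegative. -/
def AvgNonneg (u : ℕ → ℝ) : Prop := ∀ δ > 0, ∀ᶠ n : ℕ in atTop, -(δ * n) ≤ u n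

theorem AvgNonneg.mono {u v : ℕ → ℝ} (h : AvgNonneg u) (huv : ∀ n, u n ≤ v n) : AvgNonneg v :=
  fun δ hδ => (h δ hδ).mono fun n hn => hn.trans (huv n)

theorem AvgNonneg.add {u v : ℕ → ℝ} (hu : AvgNonneg u) (hv : AvgNonneg v) :
    AvgNonneg fun n => u n + v n := by
  intro δ hδ
  filter_upwards [hu (δ / 2) (half_pos hδ), hv (δ / 2) (half_pos hδ)] with n h1 h2
  linarith

theorem AvgNonneg.const_mul {u : ℕ → ℝ} (hu : AvgNonneg u) {c : ℝ} (hc : 0 ≤ c) :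
    AvgNonneg fun n => c * u n := by
  intro δ hδ
  filter_upwards [hu (δ / (c + 1)) (by positivity)] with n h1
  have h2 : c * -(δ / (c + 1) * n) ≤ c * u n := mul_le_mul_of_nonneg_left h1 hc
  have h3 : c * (δ / (c + 1) * n) ≤ δ * n := by
    have : c / (c + 1) ≤ 1 := (div_le_one (by positivity)).2 (by linarith)
    calc c * (δ / (c + 1) * n) = c / (c + 1) * (δ * n) := by ring
      _ ≤ 1 * (δ * n) := mul_le_mul_of_nonneg_right this (by positivity)
      _ = δ * n := one_mul _
  linarith

theorem avgNonneg_of_tendsto_zero {u : ℕ → ℝ}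
    (h : Tendsto (fun n : ℕ => u n / n) atTop (𝓝 0)) : AvgNonneg u := by
  intro δ hδ
  filter_upwards [h.eventually (lt_mem_nhds (neg_lt_zero.2 hδ)), eventually_gt_atTop 0]
    with n hn hn0
  have hn0' : (0 : ℝ) < n := by exact_mod_cast hn0
  have := (lt_div_iff₀ hn0').1 hn
  linarith

theorem avgNonneg_neg_of_tendsto_zero {u : ℕ → ℝ}
    (h : Tendsto (fun n : ℕ => u n / n) atTop (𝓝 0)) : AvgNonneg fun n => -u n :=
  avgNonneg_of_tendsto_zero (by simpa [neg_div] using h.neg)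

theorem AvgNonneg.eventually_le {v : ℕ → ℝ} {ε : ℝ} (hε : 0 < ε)
    (hv : AvgNonneg fun n => v n - ε * n) : ∀ᶠ n : ℕ in atTop, ε / 2 * n ≤ v n := by
  filter_upwards [hv (ε / 2) (half_pos hε)] with n hn
  linarith

/-- If `u - k v` has nonnegative averages and `v` grows linearly, then the averages of `u - a v`
are bounded away from zero for every `a < k`. -/
theorem AvgNonneg.eventually_lt {u v : ℕ → ℝ} {k a ε : ℝ} (hε : 0 < ε) (ha : a < k)
    (hv : AvgNonneg fun n => v n - ε * n) (hu : AvgNonneg fun n => u n - k * v n) :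
    ∃ η > 0, ∀ᶠ n : ℕ in atTop, η * n ≤ u n - a * v n := by
  -- Call this number η. Eventually v ≥ (ε/2) n, so (k - a) v ≥ 2η n, while u - k v loses at most η
  -- n.
  have hη : 0 < (k - a) * (ε / 2) / 2 := by have := sub_pos.2 ha; positivity
  refine ⟨_, hη, ?_⟩
  filter_upwards [hu _ hη, hv.eventually_le hε] with n h1 h2
  have := mul_le_mul_of_nonneg_left h2 (sub_pos.2 ha).le
  linarith

/-- Reduces a bound on extended ratios to linear inequalities with finite nonnegative slopes. For `k
≤ 0` nothing is claimed, since then `ENNReal.ofReal k = 0`. -/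
theorem ofReal_le_liminf_div {ι : Type*} {l : Filter ι} {u v : ι → ℝ≥0∞} {k : ℝ}
    (hv : ∀ᶠ i in l, v i ≠ 0 ∧ v i ≠ ⊤)
    (h : ∀ a : ℝ≥0, (a : ℝ) < k → ∀ᶠ i in l, a * v i ≤ u i) :
    ENNReal.ofReal k ≤ liminf (fun i => u i / v i) l := by
  refine le_of_forall_lt fun b hb => ?_
  obtain ⟨c, hbc, hc⟩ := exists_between hb
  lift c to ℝ≥0 using (hc.trans ENNReal.ofReal_lt_top).ne
  refine hbc.trans_le (le_liminf_of_le (by isBoundedDefault) ?_)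
  have hck : (c : ℝ) < k := by
    rw [ENNReal.ofReal, ENNReal.coe_lt_coe] at hc
    exact Real.lt_toNNReal_iff_coe_lt.1 hc
  filter_upwards [hv, h c hck] with i h1 h2
  exact (ENNReal.le_div_iff_mul_le (.inl h1.1) (.inl h1.2)).2 h2

theorem limsup_div_le_ofReal {ι : Type*} {l : Filter ι} {u v : ι → ℝ≥0∞} {k : ℝ}
    (h : ∀ a : ℝ≥0, k < (a : ℝ) → ∀ᶠ i in l, u i ≤ a * v i) :
    limsup (fun i => u i / v i) l ≤ ENNReal.ofReal k := by
  refine le_of_forall_gt fun b hb => ?_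
  obtain ⟨c, hc, hbc⟩ := exists_between hb
  lift c to ℝ≥0 using (hbc.trans_le le_top).ne
  refine (limsup_le_of_le (by isBoundedDefault) ?_).trans_lt hbc
  have hck : k < (c : ℝ) := by
    rw [ENNReal.ofReal, ENNReal.coe_lt_coe] at hc
    exact (Real.le_coe_toNNReal k).trans_lt (by exact_mod_cast hc)
  filter_upwards [h c hck] with i h1
  exact ENNReal.div_le_of_le_mul h1

/-! ### The costs along a path of an MDP -/

namespace MDP

variable {S B : Type*} [Fintype S]

/-- The expected value of `x` after taking `β` in `s`. -/
def expNext (M : MDP S B) (x : S → ℝ) (s : S) (β : B) : ℝ := ∑ s', (M.P s β s' : ℝ) * x s'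

/-- Replacing the next state by the current one telescopes: the sums differ by `x (q n) - x (q 0)`,
which is bounded because `S` is finite. -/
theorem tendsto_sum_sub_expNext {M : MDP S B} {x : S → ℝ} {q : ℕ → S} {b : ℕ → B}
    (h : Tendsto (fun n : ℕ => (∑ i ∈ Finset.range n, (x (q (i + 1)) - M.expNext x (q i) (b i))) / n)
      atTop (𝓝 0)) :
    Tendsto (fun n : ℕ => (∑ i ∈ Finset.range n, (x (q i) - M.expNext x (q i) (b i))) / n)
      atTop (𝓝 0) := by
  have hb : ∀ n, |x (q n) - x (q 0)| ≤ 2 * ∑ s, |x s| := by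
    intro n
    have h1 : ∀ s, |x s| ≤ ∑ s, |x s| := fun s =>
      Finset.single_le_sum (f := fun s => |x s|) (fun _ _ => abs_nonneg _) (Finset.mem_univ s)
    have := abs_sub (x (q n)) (x (q 0))
    linarith [h1 (q n), h1 (q 0)]
  have h2 : Tendsto (fun n : ℕ => (x (q n) - x (q 0)) / n) atTop (𝓝 0) := by
    refine squeeze_zero_norm (fun n => ?_)
      (tendsto_const_div_atTop_nhds_zero_nat (2 * ∑ s, |x s|))
    rw [Real.norm_eq_abs, abs_div, Nat.abs_cast]
    exact div_le_div_of_nonneg_right (hb n) (Nat.cast_nonneg n)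
  have h3 := h.sub h2
  rw [sub_zero] at h3
  refine h3.congr fun n => ?_
  rw [← Finset.sum_range_sub (fun i => x (q i)), ← sub_div, ← Finset.sum_sub_distrib]
  exact congrArg (· / (n : ℝ)) (Finset.sum_congr rfl fun i _ => by ring)

/-- Along a path that satisfies the law of large numbers for `x`, a feasible point `(k, x)` of the
linear program bounds the ratio of the accumulated costs. -/
theorem LPFeasible.avgNonneg {M : MDP S B} {c₁ c₂ : S → B → ℝ≥0} {k : ℝ} {x : S → ℝ}
    (hf : M.LPFeasible c₁ c₂ k x) {q : ℕ → S} {b : ℕ → B} (hb : ∀ n, b n ∈ M.enabled (q n))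
    (h : Tendsto (fun n : ℕ => (∑ i ∈ Finset.range n, (x (q (i + 1)) - M.expNext x (q i) (b i))) / n)
      atTop (𝓝 0)) :
    AvgNonneg fun n => ∑ i ∈ Finset.range n, (c₁ (q i) (b i) : ℝ) -
      k * ∑ i ∈ Finset.range n, (c₂ (q i) (b i) : ℝ) := by
  refine (avgNonneg_of_tendsto_zero (tendsto_sum_sub_expNext h)).mono fun n => ?_
  rw [Finset.mul_sum, ← Finset.sum_sub_distrib]
  refine Finset.sum_le_sum fun i _ => ?_
  have := hf (q i) (b i) (hb i)
  unfold expNext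
  linarith

/-- Along labels chosen by `d` the constraints of the linear program are equalities, which gives the
reverse of `LPFeasible.avgNonneg`. -/
theorem avgNonneg_of_equation {M : MDP S B} {c₁ c₂ : S → B → ℝ≥0} {k : ℝ} {x : S → ℝ}
    {d : S → B} (hd : ∀ s, x s = c₁ s (d s) - k * c₂ s (d s) + ∑ s', (M.P s (d s) s' : ℝ) * x s')
    {q : ℕ → S} {b : ℕ → B} (hb : ∀ n, b n = d (q n))
    (h : Tendsto (fun n : ℕ => (∑ i ∈ Finset.range n, (x (q (i + 1)) - M.expNext x (q i) (b i))) / n)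
      atTop (𝓝 0)) :
    AvgNonneg fun n => k * ∑ i ∈ Finset.range n, (c₂ (q i) (b i) : ℝ) -
      ∑ i ∈ Finset.range n, (c₁ (q i) (b i) : ℝ) := by
  refine (avgNonneg_neg_of_tendsto_zero (tendsto_sum_sub_expNext h)).mono fun n => ?_
  rw [Finset.mul_sum, ← Finset.sum_sub_distrib, ← Finset.sum_neg_distrib]
  refine Finset.sum_le_sum fun i _ => ?_
  have := hd (q i)
  rw [hb i]
  unfold expNext
  linarith

end MDP

theorem memLp_comp_of_finite {X F : Type*} [MeasurableSpace X] [Fintype F] [MeasurableSpace F]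
    [DiscreteMeasurableSpace F] {μ : Measure X} [IsFiniteMeasure μ] {φ : X → F}
    (hφ : Measurable φ) (g : F → ℝ) (p : ℝ≥0∞) : MemLp (fun y => g (φ y)) p μ :=
  MemLp.of_bound ((Measurable.of_discrete (f := g)).comp hφ).aestronglyMeasurable (∑ a, |g a|)
    (ae_of_all _ fun y => Finset.single_le_sum (f := fun a => |g a|) (fun _ _ => abs_nonneg _)
      (Finset.mem_univ (φ y)))

section traj

variable {X S L : Type*} [MeasurableSpace X] [Fintype S] [Fintype L]
  [MeasurableSpace S] [DiscreteMeasurableSpace S] [MeasurableSpace L] [DiscreteMeasurableSpace L]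
  {κ : (n : ℕ) → Kernel ((i : Finset.Iic n) → X) X} [∀ n, IsMarkovKernel (κ n)]
  {state : X → S} {label : X → L} {ρ : S → L → Measure X} [∀ s σ, IsProbabilityMeasure (ρ s σ)]
  {w : (n : ℕ) → ((i : Finset.Iic n) → X) → L → ℝ≥0∞}

/-- The law of large numbers for functions of the state, for a process that is governed by the
transition probabilities of an MDP. -/
theorem MDP.ae_tendsto_sum_sub_expNext (M : MDP S L)
    (hκ : ∀ n h, κ n h = ∑ σ, w n h σ • ρ (state (lastEntry h)) σ)
    (hstate : Measurable state) (hlabel : Measurable label)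
    (hρlabel : ∀ s σ, ∀ᵐ y ∂ρ s σ, label y = σ) {next : S → L → PMF S}
    (hρstate : ∀ s σ, (ρ s σ).map state = (next s σ).toMeasure)
    (hnext : ∀ s, ∀ σ ∈ M.enabled s, ∀ s', next s σ s' = M.P s σ s')
    (hw : ∀ n h σ, w n h σ ≠ 0 → σ ∈ M.enabled (state (lastEntry h)))
    (x₀ : (i : Finset.Iic 0) → X) (x : S → ℝ) :
    ∀ᵐ π ∂Kernel.traj (X := fun _ => X) κ 0 x₀,
      (∀ n, label (π (n + 1)) ∈ M.enabled (state (π n))) ∧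
      Tendsto (fun n : ℕ => (∑ i ∈ Finset.range n, (x (state (π (i + 1))) -
        M.expNext x (state (π i)) (label (π (i + 1))))) / n) atTop (𝓝 0) := by
  have hen := ae_traj_transition hκ hstate (p := fun s y => label y ∈ M.enabled s)
    (fun s => hlabel (MeasurableSet.of_discrete (s := M.enabled s)))
    (fun n h σ hσ => by
      filter_upwards [hρlabel (state (lastEntry h)) σ] with y hy
      rw [hy]
      exact hw n h σ hσ) x₀
  -- Centring uses `next`, a probability distribution even for disabled labels, so the mean vanishes
  -- for every label; the transition probabilities `M.P` enter only at the end, along enabled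
  -- labels.
  let g : S → L × S → ℝ := fun s p => x p.2 - ∑ s', (next s p.1 s').toReal * x s'
  have hlln := ae_tendsto_traj_sum_div hκ hstate (f := fun s y => g s (label y, state y))
    (fun s => (Measurable.of_discrete (f := g s)).comp (hlabel.prodMk hstate))
    (fun s σ => memLp_comp_of_finite (hlabel.prodMk hstate) (g s) 2)
    (fun s σ => by
      have h1 : ∫ y, g s (label y, state y) ∂ρ s σ =
          ∫ y, x (state y) - ∑ s', (next s σ s').toReal * x s' ∂ρ s σ := by
        refine integral_congr_ae ?_
        filter_upwards [hρlabel s σ] with y hy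
        simp [g, hy]
      rw [h1, integral_sub ((memLp_comp_of_finite hstate x 1).integrable le_rfl)
        (integrable_const _), ← integral_map (f := x) hstate.aemeasurable
          (Measurable.of_discrete (f := x)).aestronglyMeasurable,
        hρstate, PMF.integral_eq_sum]
      simp) x₀
  filter_upwards [hen, hlln] with π h1 h2
  refine ⟨h1, h2.congr fun n => congrArg (· / (n : ℝ)) (Finset.sum_congr rfl fun i _ => ?_)⟩
  simp only [g, MDP.expNext]
  congr 1
  refine Finset.sum_congr rfl fun s' _ => ?_
  rw [hnext _ _ (h1 i)]
  simp

end traj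

/-! ### Long-run cost ratios under the policies of the MDP. -/

namespace MDP

variable {S B : Type*} [Fintype S] [Fintype B] [Inhabited B]
  [MeasurableSpace S] [DiscreteMeasurableSpace S] [MeasurableSpace B] [DiscreteMeasurableSpace B]

theorem next_apply {S B : Type*} [Fintype S] {M : MDP S B} {s : S} {β : B} (h : β ∈ M.enabled s) (s' : S) :
    M.next s β s' = M.P s β s' := by
  simp [next, sum_eq_one_of_mem_enabled h]

namespace Policy

variable {M : MDP S B}

theorem ae_tendsto_sum_sub_expNext (D : M.Policy) (s : S) (x : S → ℝ) :
    ∀ᵐ π ∂D.pathMeasure s, (∀ n, (π (n + 1)).1 ∈ M.enabled (π n).2) ∧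
      Tendsto (fun n : ℕ => (∑ i ∈ Finset.range n, (x (π (i + 1)).2 -
        M.expNext x (π i).2 (π (i + 1)).1)) / n) atTop (𝓝 0) :=
  M.ae_tendsto_sum_sub_expNext (κ := D.kernel) (state := Prod.snd) (label := Prod.fst)
    (ρ := fun s β => (Measure.dirac β).prod (M.next s β).toMeasure) (w := fun n h => D.choice n h)
    (fun _ _ => rfl) measurable_snd measurable_fst
    (fun s β => by
      refine ae_of_ae_map (p := fun b => b = β) measurable_fst.aemeasurable ?_
      rw [Measure.map_fst_prod]
      simp [ae_dirac_eq])
    (next := M.next) (fun s β => by rw [Measure.map_snd_prod]; simp)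
    (fun _ _ h s' => next_apply h s') (fun n h σ hσ => D.enabled n h σ hσ) _ x

theorem ae_stationary {d : S → B} (hd : M.IsStationary d) (s : S) :
    ∀ᵐ π ∂(M.stationary d hd).pathMeasure s, ∀ n, (π (n + 1)).1 = d (π n).2 :=
  ae_traj_transition (κ := (M.stationary d hd).kernel) (state := Prod.snd)
    (ρ := fun s β => (Measure.dirac β).prod (M.next s β).toMeasure)
    (w := fun n h => (M.stationary d hd).choice n h)
    (p := fun q y => y.1 = d q) (fun _ _ => rfl) measurable_snd
    (fun q => measurable_fst (MeasurableSet.of_discrete (s := {d q})))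
    (fun n h σ hσ => by
      have hσ' : σ = d (History.last h) := by
        rwa [← PMF.mem_support_iff, stationary, PMF.mem_support_pure_iff] at hσ
      refine ae_of_ae_map (p := fun b => b = d (History.last h)) measurable_fst.aemeasurable ?_
      rw [Measure.map_fst_prod, hσ']
      simp [ae_dirac_eq]) _

variable {c₁ c₂ : S → B → ℝ≥0} {k ε : ℝ} {x y : S → ℝ}

/-- The point `(k, x)` bounds the accumulated costs up to o(n); the point `(ε, y)` makes the
denominator grow linearly, so that this error vanishes in the ratio. -/
theorem ae_le_liminf_costRatio (D : M.Policy) (s : S) (hf : M.LPFeasible c₁ c₂ k x) (hε : 0 < ε)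
    (hy : M.LPFeasible c₂ (fun _ _ => 1) ε y) :
    ∀ᵐ π ∂D.pathMeasure s,
      ENNReal.ofReal k ≤ liminf (fun n => costRatio c₁ c₂ n π) atTop := by
  filter_upwards [D.ae_tendsto_sum_sub_expNext s x, D.ae_tendsto_sum_sub_expNext s y]
    with π ⟨hen, hx⟩ ⟨_, hy'⟩
  have hu := hf.avgNonneg (q := fun n => (π n).2) (b := fun n => (π (n + 1)).1) hen hx
  have hv := hy.avgNonneg (q := fun n => (π n).2) (b := fun n => (π (n + 1)).1) hen hy'
  simp only [NNReal.coe_one, Finset.sum_const, Finset.card_range, nsmul_eq_mul, mul_one] at hv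
  refine ofReal_le_liminf_div ?_ fun a ha => ?_
  · filter_upwards [hv.eventually_le hε, eventually_gt_atTop 0] with n hn hn0
    have hn0' : (0 : ℝ) < n := by exact_mod_cast hn0
    have h1 : (0 : ℝ) < ∑ i ∈ Finset.range n, (c₂ (π i).2 (π (i + 1)).1 : ℝ) :=
      lt_of_lt_of_le (by positivity) hn
    have h2 : 0 < ∑ i ∈ Finset.range n, c₂ (π i).2 (π (i + 1)).1 := by exact_mod_cast h1
    rw [← ENNReal.ofNNReal_finsetSum]
    exact ⟨by exact_mod_cast h2.ne', ENNReal.coe_ne_top⟩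
  · obtain ⟨η, hη, h⟩ := AvgNonneg.eventually_lt hε ha hv hu
    filter_upwards [h] with n hn
    have h1 : (a : ℝ) * ∑ i ∈ Finset.range n, (c₂ (π i).2 (π (i + 1)).1 : ℝ) ≤
        ∑ i ∈ Finset.range n, (c₁ (π i).2 (π (i + 1)).1 : ℝ) := by
      have : 0 ≤ η * n := by positivity
      linarith
    exact_mod_cast h1

theorem ae_tendsto_costRatio_stationary {d : S → B} (hd : M.IsStationary d) (s : S)
    (hf : M.LPFeasible c₁ c₂ k x)
    (hdx : ∀ s, x s = c₁ s (d s) - k * c₂ s (d s) + ∑ s', (M.P s (d s) s' : ℝ) * x s')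
    (hε : 0 < ε) (hy : M.LPFeasible c₂ (fun _ _ => 1) ε y) :
    ∀ᵐ π ∂(M.stationary d hd).pathMeasure s,
      Tendsto (fun n => costRatio c₁ c₂ n π) atTop (𝓝 (ENNReal.ofReal k)) := by
  filter_upwards [(M.stationary d hd).ae_tendsto_sum_sub_expNext s x,
    (M.stationary d hd).ae_tendsto_sum_sub_expNext s y, ae_stationary hd s,
    (M.stationary d hd).ae_le_liminf_costRatio s hf hε hy] with π ⟨hen, hx⟩ ⟨_, hy'⟩ hst hlow
  have hu := avgNonneg_of_equation hdx (q := fun n => (π n).2) (b := fun n => (π (n + 1)).1) hst hx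
  have hv := hy.avgNonneg (q := fun n => (π n).2) (b := fun n => (π (n + 1)).1) hen hy'
  simp only [NNReal.coe_one, Finset.sum_const, Finset.card_range, nsmul_eq_mul, mul_one] at hv
  refine tendsto_of_le_liminf_of_limsup_le hlow (limsup_div_le_ofReal fun a ha => ?_)
  -- The upper bound is the lower bound for the negated numerator.
  obtain ⟨η, hη, h⟩ := AvgNonneg.eventually_lt (k := -k) (a := -a)
    (u := fun n => -∑ i ∈ Finset.range n, (c₁ (π i).2 (π (i + 1)).1 : ℝ)) hε (neg_lt_neg ha) hv
    (by simpa [sub_eq_add_neg, add_comm] using hu)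
  filter_upwards [h] with n hn
  have h1 : ∑ i ∈ Finset.range n, (c₁ (π i).2 (π (i + 1)).1 : ℝ) ≤
      (a : ℝ) * ∑ i ∈ Finset.range n, (c₂ (π i).2 (π (i + 1)).1 : ℝ) := by
    have : 0 ≤ η * n := by positivity
    linarith
  exact_mod_cast h1

end Policy

end MDP

/-! ### The exponential distribution -/

theorem gammaPDF_one_toReal {r x : ℝ} (hr : 0 < r) (hx : 0 < x) :
    (gammaPDF 1 r x).toReal = r * Real.exp (-(r * x)) := by
  rw [gammaPDF_of_nonneg hx.le, ENNReal.toReal_ofReal (by positivity)]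
  simp

/-- `max x 0` is the real value of `Real.toNNReal x`, the form in which sojourn times arise. A
nonzero exponent makes the product vanish at 0, where the density does not. -/
theorem max_pow_mul_gammaPDF {r : ℝ} (hr : 0 < r) {n : ℕ} (hn : n ≠ 0) (x : ℝ) :
    max x 0 ^ n * (gammaPDF 1 r x).toReal =
      (Set.Ioi (0 : ℝ)).indicator (fun x => r * (x ^ n * Real.exp (-(r * x)))) x := by
  by_cases hx : 0 < x
  · rw [gammaPDF_one_toReal hr hx, max_eq_left hx.le, Set.indicator_of_mem (Set.mem_Ioi.2 hx)]
    ring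
  · rw [max_eq_right (not_lt.1 hx), Set.indicator_of_notMem (by simpa using hx), zero_pow hn,
      zero_mul]

theorem measurable_gammaPDF (a r : ℝ) : Measurable (gammaPDF a r) :=
  (measurable_gammaPDFReal a r).ennreal_ofReal

theorem integrable_max_pow_expMeasure {r : ℝ} (hr : 0 < r) {n : ℕ} (hn : n ≠ 0) :
    Integrable (fun x : ℝ => max x 0 ^ n) (expMeasure r) := by
  rw [expMeasure, gammaMeasure, integrable_withDensity_iff (measurable_gammaPDF 1 r)
    (ae_of_all _ fun x => by simp [gammaPDF])]
  simp only [max_pow_mul_gammaPDF hr hn]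
  rw [integrable_indicator_iff measurableSet_Ioi]
  have := integrableOn_rpow_mul_exp_neg_mul_rpow (p := 1) (s := n) (b := r)
    (by have : (0 : ℝ) ≤ n := n.cast_nonneg
        linarith) zero_lt_one hr
  simp only [Real.rpow_natCast, Real.rpow_one, neg_mul] at this
  exact this.const_mul r

theorem integral_max_expMeasure {r : ℝ} (hr : 0 < r) :
    ∫ x : ℝ, max x 0 ∂expMeasure r = 1 / r := by
  rw [expMeasure, gammaMeasure, integral_withDensity_eq_integral_toReal_smul
    (measurable_gammaPDF 1 r) (ae_of_all _ fun x => by simp [gammaPDF])]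
  have h1 : ∀ x, (gammaPDF 1 r x).toReal • max x 0 =
      (Set.Ioi (0 : ℝ)).indicator (fun x => r * (x ^ ((2 : ℝ) - 1) * Real.exp (-(r * x)))) x := by
    intro x
    have := max_pow_mul_gammaPDF hr one_ne_zero x
    simp only [pow_one] at this
    rw [smul_eq_mul, mul_comm, this]
    norm_num
  simp only [h1]
  rw [integral_indicator measurableSet_Ioi, integral_const_mul,
    Real.integral_rpow_mul_exp_neg_mul_Ioi two_pos hr]
  rw [Real.Gamma_two]
  norm_num
  field_simp

/-! ### Interpolation between the members of a sequence of times -/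

/-- Divergence of `T` puts every `t ≥ 0` between consecutive members, found by the first one
exceeding `t`; its index is nonzero because `T 0 = 0`, and it is large when `t` is. -/
theorem eventually_of_forall_mem_Icc {T : ℕ → ℝ} (hmono : Monotone T) (h0 : T 0 = 0)
    (htop : Tendsto T atTop atTop) {p : ℝ → Prop}
    (h : ∀ᶠ n in atTop, ∀ t, T n ≤ t → t ≤ T (n + 1) → p t) : ∀ᶠ t in atTop, p t := by
  classical
  obtain ⟨N, hN⟩ := eventually_atTop.1 h
  filter_upwards [eventually_gt_atTop (T N), eventually_ge_atTop 0] with t ht ht0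
  have hex : ∃ n, t < T n := (htop.eventually_gt_atTop t).exists
  have hne : Nat.find hex ≠ 0 := by
    intro h'
    have := Nat.find_spec hex
    rw [h', h0] at this
    linarith
  obtain ⟨n, hn⟩ := Nat.exists_eq_succ_of_ne_zero hne
  have h1 : t < T (n + 1) := by have := Nat.find_spec hex; rwa [hn] at this
  have h2 : T n ≤ t := not_lt.1 (Nat.find_min hex (by omega))
  refine hN n ?_ t h2 h1.le
  by_contra! hlt
  have := hmono (show n + 1 ≤ N from hlt)
  linarith

/-! ### Occupation times of a timed path. -/

namespace MarkovAutomaton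

variable {S A : Type*}

namespace Path

variable (π : Path S A)

theorem elapsed_succ (n : ℕ) : Path.elapsed π (n + 1) = Path.elapsed π n + Path.sojourn π n :=
  Finset.sum_range_succ _ _

theorem elapsed_mono : Monotone (Path.elapsed π) :=
  monotone_nat_of_le_succ fun n => by rw [elapsed_succ]; exact le_self_add

/-- The times at which a state of `G` is occupied. -/
def occupied (G : Set S) : Set ℝ := {u | (G ∩ Path.statesAt π u).Nonempty}

/-- The time spent in `G` up to time `t`. -/
def occupation (G : Set S) (t : ℝ) : ℝ≥0∞ := volume (occupied π G ∩ Set.Icc 0 t)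

theorem mem_occupied {G : Set S} {u : ℝ} : u ∈ occupied π G ↔
    ∃ n, Path.state π n ∈ G ∧ u ∈ Set.Icc (Path.elapsed π n : ℝ) (Path.elapsed π (n + 1)) := by
  constructor
  · rintro ⟨q, hq, n, rfl, h1, h2⟩
    exact ⟨n, hq, h1, h2⟩
  · rintro ⟨n, hq, h1, h2⟩
    exact ⟨_, hq, n, rfl, h1, h2⟩

theorem measurableSet_occupied (G : Set S) : MeasurableSet (occupied π G) := by
  have : occupied π G = ⋃ n, ⋃ _ : Path.state π n ∈ G,
      Set.Icc (Path.elapsed π n : ℝ) (Path.elapsed π (n + 1)) := by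
    ext u
    simp only [mem_occupied, Set.mem_iUnion, exists_prop]
  rw [this]
  exact MeasurableSet.iUnion fun n => MeasurableSet.iUnion fun _ => measurableSet_Icc

theorem timeFraction_eq (G : Set S) (t : ℝ) :
    timeFraction G t π = occupation π G t / ENNReal.ofReal t := by
  unfold timeFraction occupation
  congr 1
  rw [← Measure.restrict_apply (measurableSet_occupied π G),
    ← lintegral_indicator_one (measurableSet_occupied π G)]
  rfl

theorem occupation_mono (G : Set S) : Monotone (occupation π G) := fun _ _ h =>
  measure_mono (Set.inter_subset_inter_right _ (Set.Icc_subset_Icc_right h))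

/-- Closed sojourn intervals share their endpoints, and several states may be occupied at one
instant; this concerns only a null set, so sojourns in `G` simply add up. -/
theorem occupation_elapsed (G : Set S) (n : ℕ) :
    occupation π G (Path.elapsed π n) =
      ENNReal.ofReal (∑ i ∈ Finset.range n, G.indicator 1 (Path.state π i) * (Path.sojourn π i : ℝ)) := by
  induction n with
  | zero =>
    refine le_antisymm ((measure_mono Set.inter_subset_right).trans ?_) (by simp)
    simp [Path.elapsed]
  | succ n ih =>
    have hle : (Path.elapsed π n : ℝ) ≤ Path.elapsed π (n + 1) := elapsed_mono π n.le_succ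
    have hsplit : occupied π G ∩ Set.Icc 0 (Path.elapsed π (n + 1) : ℝ) =
        (occupied π G ∩ Set.Icc 0 (Path.elapsed π n : ℝ)) ∪
          (occupied π G ∩ Set.Ioc (Path.elapsed π n : ℝ) (Path.elapsed π (n + 1))) := by
      rw [← Set.inter_union_distrib_left, Set.Icc_union_Ioc_eq_Icc (NNReal.coe_nonneg _) hle]
    have hdisj : Disjoint (occupied π G ∩ Set.Icc 0 (Path.elapsed π n : ℝ))
        (occupied π G ∩ Set.Ioc (Path.elapsed π n : ℝ) (Path.elapsed π (n + 1))) :=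
      Set.disjoint_left.2 fun u h1 h2 => absurd h1.2.2 (not_le.2 h2.2.1)
    have hstep : volume (occupied π G ∩
          Set.Ioc (Path.elapsed π n : ℝ) (Path.elapsed π (n + 1))) =
        ENNReal.ofReal (G.indicator 1 (Path.state π n) * (Path.sojourn π n : ℝ)) := by
      by_cases hG : Path.state π n ∈ G
      · have : occupied π G ∩ Set.Ioc (Path.elapsed π n : ℝ) (Path.elapsed π (n + 1)) =
            Set.Ioc (Path.elapsed π n : ℝ) (Path.elapsed π (n + 1)) :=
          Set.inter_eq_right.2 fun u hu => (mem_occupied π).2 ⟨n, hG, hu.1.le, hu.2⟩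
        rw [this, Real.volume_Ioc, elapsed_succ]
        simp [hG]
      · rw [Set.indicator_of_notMem hG, zero_mul, ENNReal.ofReal_zero]
        -- Earlier sojourns end by the left endpoint, which is excluded, and later ones start no
        -- earlier than the right endpoint; only the latter can be occupied.
        refine measure_mono_null (t := {(Path.elapsed π (n + 1) : ℝ)}) ?_ (by simp)
        rintro u ⟨hu, h1, h2⟩
        obtain ⟨m, hm, h3, h4⟩ := (mem_occupied π).1 hu
        rcases lt_trichotomy m n with hmn | rfl | hmn
        · have : (Path.elapsed π (m + 1) : ℝ) ≤ Path.elapsed π n := elapsed_mono π hmn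
          linarith
        · exact absurd hm hG
        · have : (Path.elapsed π (n + 1) : ℝ) ≤ Path.elapsed π m := elapsed_mono π hmn
          exact le_antisymm h2 (this.trans h3)
    have hnn : ∀ i, 0 ≤ G.indicator (1 : S → ℝ) (Path.state π i) * (Path.sojourn π i : ℝ) := fun i =>
      mul_nonneg (Set.indicator_nonneg (fun _ _ => zero_le_one) _) (NNReal.coe_nonneg _)
    unfold occupation at ih ⊢
    rw [hsplit, measure_union hdisj ((measurableSet_occupied π G).inter measurableSet_Ioc), ih,
      hstep, Finset.sum_range_succ, ENNReal.ofReal_add (Finset.sum_nonneg fun i _ => hnn i) (hnn n)]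

section limits

variable {π} {G : Set S} {k ε : ℝ}

theorem tendsto_elapsed (hε : 0 < ε) (hv : AvgNonneg fun n => (Path.elapsed π n : ℝ) - ε * n) :
    Tendsto (fun n => (Path.elapsed π n : ℝ)) atTop atTop :=
  tendsto_atTop_mono' _ (hv.eventually_le hε)
    (tendsto_natCast_atTop_atTop.const_mul_atTop (half_pos hε))

/-- The fraction of time spent in `G` is asymptotically at least `k` if it is so at the jump
times and the sojourn times grow sublinearly. -/
theorem ofReal_le_liminf_timeFraction (hε : 0 < ε)
    (hv : AvgNonneg fun n => (Path.elapsed π n : ℝ) - ε * n)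
    (hs : AvgNonneg fun n => -(Path.sojourn π n : ℝ))
    (hu : AvgNonneg fun n => ∑ i ∈ Finset.range n,
      G.indicator 1 (Path.state π i) * (Path.sojourn π i : ℝ) - k * Path.elapsed π n) :
    ENNReal.ofReal k ≤ liminf (fun t : ℝ => timeFraction G t π) atTop := by
  simp only [timeFraction_eq]
  refine ofReal_le_liminf_div ?_ fun a ha => ?_
  · filter_upwards [eventually_gt_atTop 0] with t ht
    exact ⟨(ENNReal.ofReal_pos.2 ht).ne', ENNReal.ofReal_ne_top⟩
  refine eventually_of_forall_mem_Icc (T := fun n => (Path.elapsed π n : ℝ)) (fun m n h => elapsed_mono π h) (by simp [Path.elapsed])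
    (tendsto_elapsed hε hv) ?_
  obtain ⟨η, hη, h⟩ := AvgNonneg.eventually_lt hε ha hv hu
  -- The margin η n at the n-th jump pays for the growth of a t during the following sojourn, which
  -- is at most η n.
  filter_upwards [h, (hs.const_mul a.coe_nonneg) η hη] with n h1 h2 t ht1 ht2
  refine le_trans ?_ (occupation_mono π G ht1)
  rw [occupation_elapsed, ← ENNReal.ofReal_coe_nnreal, ← ENNReal.ofReal_mul a.coe_nonneg]
  refine ENNReal.ofReal_le_ofReal ((mul_le_mul_of_nonneg_left ht2 a.coe_nonneg).trans ?_)
  rw [elapsed_succ, NNReal.coe_add]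
  linarith

theorem limsup_timeFraction_le_ofReal (hε : 0 < ε)
    (hv : AvgNonneg fun n => (Path.elapsed π n : ℝ) - ε * n)
    (hs : AvgNonneg fun n => -(Path.sojourn π n : ℝ))
    (hu : AvgNonneg fun n => k * Path.elapsed π n - ∑ i ∈ Finset.range n,
      G.indicator 1 (Path.state π i) * (Path.sojourn π i : ℝ)) :
    limsup (fun t : ℝ => timeFraction G t π) atTop ≤ ENNReal.ofReal k := by
  simp only [timeFraction_eq]
  refine limsup_div_le_ofReal fun a ha => ?_
  refine eventually_of_forall_mem_Icc (T := fun n => (Path.elapsed π n : ℝ)) (fun m n h => elapsed_mono π h) (by simp [Path.elapsed])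
    (tendsto_elapsed hε hv) ?_
  obtain ⟨η, hη, h⟩ := AvgNonneg.eventually_lt (k := -k) (a := -a)
    (u := fun n => -∑ i ∈ Finset.range n, G.indicator 1 (Path.state π i) * (Path.sojourn π i : ℝ))
    hε (neg_lt_neg ha) hv (by simpa [sub_eq_add_neg, add_comm] using hu)
  -- Here the occupation is overestimated by its value at the next jump, and the margin pays for the
  -- last sojourn.
  filter_upwards [h, hs η hη] with n h1 h2 t ht1 ht2
  refine (occupation_mono π G ht2).trans ?_
  rw [occupation_elapsed, ← ENNReal.ofReal_coe_nnreal, ← ENNReal.ofReal_mul a.coe_nonneg]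
  refine ENNReal.ofReal_le_ofReal (le_trans ?_ (mul_le_mul_of_nonneg_left ht1 a.coe_nonneg))
  have h3 : G.indicator 1 (Path.state π n) * (Path.sojourn π n : ℝ) ≤ Path.sojourn π n :=
    mul_le_of_le_one_left (NNReal.coe_nonneg _)
      (Set.indicator_le_self' (f := (1 : S → ℝ)) (fun _ _ => zero_le_one) _)
  rw [Finset.sum_range_succ]
  linarith

end limits

end Path

end MarkovAutomaton

namespace MarkovAutomaton

variable {S A : Type*} [Fintype S] (M : MarkovAutomaton S A)

/-! ### The embedded MDP -/

theorem mdp_enabled (s : S) : M.mdp.enabled s = M.enabled s := by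
  ext σ
  constructor
  · rintro ⟨s', hs'⟩
    cases σ with
    | none =>
      by_contra h
      have h' : s ∉ M.MS := h
      simp [mdp, mdpP, h'] at hs'
    | some α =>
      by_contra h
      have h' : ¬ ∃ μ, (s, α, μ) ∈ M.prob := h
      simp only [mdp, mdpP, h', dif_neg, not_false_eq_true, lt_irrefl] at hs'
  · intro h
    by_contra hne
    have h0 : ∀ s', M.mdpP s σ s' = 0 := by
      intro s'
      by_contra h'
      exact hne ⟨s', pos_iff_ne_zero.2 h'⟩
    have h1 : ∑ s', M.mdpP s σ s' = 1 := by
      cases σ with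
      | none =>
        have h' : s ∈ M.MS := h
        simp only [mdpP, h', if_true, ← Finset.sum_div]
        exact div_self (M.E_pos h').ne'
      | some α =>
        have h' : ∃ μ, (s, α, μ) ∈ M.prob := h
        have h1 : ∑ s', M.dist s α h' s' = 1 := by
          rw [← tsum_fintype (L := .unconditional _)]
          exact (M.dist s α h').tsum_coe
        simp only [mdpP, h', dif_pos]
        rw [← ENNReal.toNNReal_sum (fun a _ => PMF.apply_ne_top _ _), h1, ENNReal.toNNReal_one]
    simp [h0] at h1

theorem next_eq_mdpP {s : S} {σ : Option A} (h : σ ∈ M.enabled s) (s' : S) :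
    M.next s σ s' = M.mdpP s σ s' := by
  cases σ with
  | none =>
    have h' : s ∈ M.MS := h
    simp [next, mdpP, (M.E_pos h').ne', h']
  | some α =>
    have h' : ∃ μ, (s, α, μ) ∈ M.prob := h
    simp only [next, mdpP, h', dif_pos]
    exact (ENNReal.coe_toNNReal (PMF.apply_ne_top _ _)).symm

theorem mdp_isStationary {d : S → Option A} : M.mdp.IsStationary d ↔ M.IsStationary d :=
  forall_congr' fun s => by rw [mdp_enabled]

theorem Unichain.mdp {M : MarkovAutomaton S A} (h : M.Unichain) : M.mdp.IsUnichain := by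
  intro d hd s s'
  have hd' := M.mdp_isStationary.1 hd
  refine Relation.ReflTransGen.mono (fun a b hab => ?_) s s' (h d hd' s s')
  unfold Edge at hab
  rw [M.next_eq_mdpP (hd' a)] at hab
  exact pos_iff_ne_zero.2 (by exact_mod_cast hab)

theorem eq_none_of_mem_enabled {S A : Type*} (M : MarkovAutomaton S A) {s : S} {σ : Option A} (hs : s ∈ M.MS) (h : σ ∈ M.enabled s) :
    σ = none := by
  cases σ with
  | none => rfl
  | some α => exact absurd ⟨α, h⟩ hs.1

theorem enabled_nonempty {S A : Type*} (M : MarkovAutomaton S A) (hdead : M.DeadlockFree) (s : S) : (M.enabled s).Nonempty := by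
  rcases hdead s with ⟨α, μ, h⟩ | h
  · exact ⟨some α, μ, h⟩
  · exact ⟨none, h⟩

/-- Without Markovian states the whole state space, strongly connected by the unichain property,
would be a Zeno set. -/
theorem exists_cost₂_pos (hdead : M.DeadlockFree) (hzeno : M.NonZeno) (huni : M.Unichain)
    {d : S → Option A} (hd : M.IsStationary d) : ∃ s, 0 < M.cost₂ s (d s) := by
  obtain ⟨s, hs⟩ : ∃ s, s ∈ M.MS := by
    by_contra! h
    exact hzeno d hd ⟨Set.univ, ⟨M.init, trivial⟩, fun s _ => (hdead s).resolve_right (h s),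
      fun _ _ _ _ => trivial, fun s _ s' _ => huni d hd s s'⟩
  refine ⟨s, ?_⟩
  simp [cost₂, hs, M.eq_none_of_mem_enabled hs (hd s), M.E_pos hs]

open Classical in
/-- The mean sojourn time in a state. -/
def meanSojourn (s : S) : ℝ := if s ∈ M.MS then 1 / M.E s else 0

/-- Only `⊥` is enabled in a Markovian state, so along enabled labels the cost depends on the state
alone and can be compared with sojourn times. -/
theorem cost₂_eq_meanSojourn {s : S} {σ : Option A} (h : σ ∈ M.enabled s) :
    (M.cost₂ s σ : ℝ) = M.meanSojourn s := by
  by_cases hs : s ∈ M.MS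
  · simp [cost₂, meanSojourn, hs, M.eq_none_of_mem_enabled hs h]
  · simp [cost₂, meanSojourn, hs]

theorem cost₁_eq_meanSojourn (G : Set S) {s : S} {σ : Option A} (h : σ ∈ M.enabled s) :
    (M.cost₁ G s σ : ℝ) = G.indicator 1 s * M.meanSojourn s := by
  by_cases hs : s ∈ M.MS
  · by_cases hG : s ∈ G <;> simp [cost₁, meanSojourn, hs, hG, M.eq_none_of_mem_enabled hs h]
  · simp [cost₁, meanSojourn, hs]

theorem memLp_sojournLaw (s : S) : MemLp (fun t : ℝ≥0 => (t : ℝ)) 2 (M.sojournLaw s) := by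
  by_cases h : s ∈ M.MS
  · have hE : (0 : ℝ) < M.E s := by exact_mod_cast M.E_pos h
    rw [sojournLaw, if_pos h, memLp_map_measure_iff (by fun_prop)
      measurable_real_toNNReal.aemeasurable,
      memLp_two_iff_integrable_sq (by fun_prop)]
    exact integrable_max_pow_expMeasure hE two_ne_zero
  · rw [sojournLaw, if_neg h, memLp_two_iff_integrable_sq (by fun_prop)]
    exact integrable_dirac (by simp)

theorem integral_sojournLaw (s : S) : ∫ t : ℝ≥0, (t : ℝ) ∂M.sojournLaw s = M.meanSojourn s := by
  by_cases h : s ∈ M.MS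
  · have hE : (0 : ℝ) < M.E s := by exact_mod_cast M.E_pos h
    rw [sojournLaw, if_pos h, meanSojourn, if_pos h,
      integral_map measurable_real_toNNReal.aemeasurable (by fun_prop)]
    exact integral_max_expMeasure hE
  · rw [sojournLaw, if_neg h, meanSojourn, if_neg h]
    simp

/-! ### From accumulated costs to elapsed time. -/

namespace Path

variable {M} {G : Set S} {k ε : ℝ} {y : S → ℝ}

/-- A sojourn is a bounded mean plus the difference of two consecutive partial sums, each of which
is o(n). -/
theorem avgNonneg_neg_sojourn {π : Path S A}
    (h : Tendsto (fun n : ℕ => (∑ i ∈ Finset.range n,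
      ((sojourn π i : ℝ) - M.meanSojourn (state π i))) / n) atTop (𝓝 0)) :
    AvgNonneg fun n => -(sojourn π n : ℝ) := by
  intro δ hδ
  set K := ∑ s, |M.meanSojourn s|
  -- Four shares of (δ/4) n: the sums up to n and n + 1, the mean, and the surplus δ/4 from n + 1,
  -- absorbed because n ≥ 1.
  filter_upwards [avgNonneg_of_tendsto_zero h (δ / 4) (by positivity),
    (tendsto_add_atTop_nat 1).eventually
      (avgNonneg_neg_of_tendsto_zero h (δ / 4) (by positivity)),
    (tendsto_natCast_atTop_atTop (R := ℝ)).eventually_ge_atTop (K / (δ / 4)),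
    (tendsto_natCast_atTop_atTop (R := ℝ)).eventually_ge_atTop 1] with n h1 h2 h3 h4
  have h5 : M.meanSojourn (state π n) ≤ K := (le_abs_self _).trans
    (Finset.single_le_sum (f := fun s => |M.meanSojourn s|) (fun _ _ => abs_nonneg _)
      (Finset.mem_univ _))
  have h6 := (div_le_iff₀ (by positivity)).1 h3
  have h7 := mul_le_mul_of_nonneg_left h4 hδ.le
  rw [Finset.sum_range_succ] at h2
  push_cast at h2
  linarith

/-- The accumulated costs of the embedded MDP differ from the accumulated sojourn times by an
error of law-of-large-numbers type. -/
theorem sum_sojourn_eq {π : Path S A} (hen : ∀ n, (π (n + 1)).1 ∈ M.enabled (π n).2.2) (n : ℕ) :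
    ∑ i ∈ Finset.range n, G.indicator 1 (state π i) * (sojourn π i : ℝ) -
        k * elapsed π n =
      (∑ i ∈ Finset.range n, (M.cost₁ G (π i).2.2 (π (i + 1)).1 : ℝ) -
        k * ∑ i ∈ Finset.range n, (M.cost₂ (π i).2.2 (π (i + 1)).1 : ℝ)) +
      ∑ i ∈ Finset.range n, (G.indicator 1 (state π i) - k) *
        ((sojourn π i : ℝ) - M.meanSojourn (state π i)) := by
  rw [elapsed, NNReal.coe_sum, Finset.mul_sum, Finset.mul_sum, ← Finset.sum_sub_distrib,
    ← Finset.sum_sub_distrib, ← Finset.sum_add_distrib]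
  refine Finset.sum_congr rfl fun i _ => ?_
  rw [M.cost₁_eq_meanSojourn G (hen i), M.cost₂_eq_meanSojourn (hen i)]
  unfold state
  ring

/-- Elapsed time is accumulated `cost₂` up to o(n), so the potential `y` makes it grow at rate at
least ε; this is non-Zenoness in quantitative form. -/
theorem avgNonneg_elapsed {π : Path S A} (hen : ∀ n, (π (n + 1)).1 ∈ M.enabled (π n).2.2)
    (hf : M.mdp.LPFeasible M.cost₂ (fun _ _ => 1) ε y)
    (hy : Tendsto (fun n : ℕ => (∑ i ∈ Finset.range n, (y (π (i + 1)).2.2 -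
        M.mdp.expNext y (π i).2.2 (π (i + 1)).1)) / n) atTop (𝓝 0))
    (h : Tendsto (fun n : ℕ => (∑ i ∈ Finset.range n,
      ((sojourn π i : ℝ) - M.meanSojourn (state π i))) / n) atTop (𝓝 0)) :
    AvgNonneg fun n => (elapsed π n : ℝ) - ε * n := by
  have h1 := hf.avgNonneg (q := fun n => (π n).2.2) (b := fun n => (π (n + 1)).1)
    (fun n => by rw [mdp_enabled]; exact hen n) hy
  refine (h1.add (avgNonneg_of_tendsto_zero h)).mono fun n => le_of_eq ?_
  simp only [NNReal.coe_one, Finset.sum_const, Finset.card_range, nsmul_eq_mul, mul_one]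
  rw [elapsed, NNReal.coe_sum, Finset.sum_sub_distrib,
    Finset.sum_congr rfl fun i _ => M.cost₂_eq_meanSojourn (hen i)]
  unfold state
  ring

end Path

/-! ### Long-run time fractions under the policies of the automaton. -/

namespace Policy

variable [Fintype A] [MeasurableSpace S] [DiscreteMeasurableSpace S] {M}

theorem ae_tendsto_sum_sub_expNext (D : M.Policy) (s : S) (x : S → ℝ) :
    ∀ᵐ π ∂D.pathMeasure s, (∀ n, (π (n + 1)).1 ∈ M.enabled (π n).2.2) ∧
      Tendsto (fun n : ℕ => (∑ i ∈ Finset.range n, (x (π (i + 1)).2.2 -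
        M.mdp.expNext x (π i).2.2 (π (i + 1)).1)) / n) atTop (𝓝 0) := by
  have := M.mdp.ae_tendsto_sum_sub_expNext (κ := D.kernel) (state := fun y => y.2.2)
    (label := Prod.fst)
    (ρ := fun s σ => (Measure.dirac σ).prod ((M.sojournLaw s).prod (M.next s σ).toMeasure))
    (w := fun n h => D.choice n h)
    (fun _ _ => rfl) (by fun_prop) measurable_fst
    (fun s σ => by
      refine ae_of_ae_map (p := fun b => b = σ) measurable_fst.aemeasurable ?_
      rw [Measure.map_fst_prod]
      simp [ae_dirac_eq])
    (next := M.next) (fun s σ => by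
      rw [show (fun y : Step S A => y.2.2) = Prod.snd ∘ Prod.snd from rfl,
        ← Measure.map_map measurable_snd measurable_snd, Measure.map_snd_prod, measure_univ,
        one_smul, Measure.map_snd_prod, measure_univ, one_smul])
    (fun s σ h s' => M.next_eq_mdpP (by rwa [mdp_enabled] at h) s')
    (fun n h σ hσ => by rw [mdp_enabled]; exact D.enabled n h σ hσ)
    (fun _ => (none, 0, s)) x
  simp only [mdp_enabled] at this
  exact this

/-- The law of a sojourn depends on the current state only, so its deviation from the mean is
centred whatever label is chosen. The weight `g` is later 1, for elapsed time, and the indicator of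
`G` minus k, for the comparison with costs. -/
theorem ae_tendsto_sum_sojourn (D : M.Policy) (s : S) (g : S → ℝ) :
    ∀ᵐ π ∂D.pathMeasure s, Tendsto (fun n : ℕ => (∑ i ∈ Finset.range n,
      g (Path.state π i) * ((Path.sojourn π i : ℝ) - M.meanSojourn (Path.state π i))) / n)
      atTop (𝓝 0) :=
  have hmap : ∀ s σ, ((Measure.dirac σ).prod
      ((M.sojournLaw s).prod (M.next s σ).toMeasure)).map (fun y : Step S A => y.2.1) =
        M.sojournLaw s := fun s σ => by
    rw [show (fun y : Step S A => y.2.1) = Prod.fst ∘ Prod.snd from rfl,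
      ← Measure.map_map measurable_fst measurable_snd, Measure.map_snd_prod, measure_univ,
      one_smul, Measure.map_fst_prod, measure_univ, one_smul]
  have hmem : ∀ s σ, MemLp (fun y : Step S A => (y.2.1 : ℝ)) 2 ((Measure.dirac σ).prod
      ((M.sojournLaw s).prod (M.next s σ).toMeasure)) := fun s σ =>
    (memLp_map_measure_iff (f := fun y : Step S A => y.2.1) (g := fun t : ℝ≥0 => (t : ℝ))
      (by fun_prop) (by fun_prop)).1 (by rw [hmap]; exact M.memLp_sojournLaw s)
  ae_tendsto_traj_sum_div (κ := D.kernel) (state := fun y => y.2.2)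
    (ρ := fun s σ => (Measure.dirac σ).prod ((M.sojournLaw s).prod (M.next s σ).toMeasure))
    (w := fun n h => D.choice n h) (f := fun s y => g s * ((y.2.1 : ℝ) - M.meanSojourn s))
    (fun _ _ => rfl) (by fun_prop) (fun s => by fun_prop)
    (fun s σ => ((hmem s σ).sub (memLp_const _)).const_mul _)
    (fun s σ => by
      rw [integral_const_mul, integral_sub ((hmem s σ).integrable one_le_two)
        (integrable_const _), ← integral_map (φ := fun y : Step S A => y.2.1)
          (f := fun t : ℝ≥0 => (t : ℝ)) (by fun_prop) (by fun_prop), hmap,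
        M.integral_sojournLaw]
      simp) _

theorem ae_stationary {d : S → Option A} (hd : M.IsStationary d) (s : S) :
    ∀ᵐ π ∂(M.stationary d hd).pathMeasure s, ∀ n, (π (n + 1)).1 = d (π n).2.2 :=
  ae_traj_transition (κ := (M.stationary d hd).kernel) (state := fun y => y.2.2)
    (ρ := fun s σ => (Measure.dirac σ).prod ((M.sojournLaw s).prod (M.next s σ).toMeasure))
    (w := fun n h => (M.stationary d hd).choice n h)
    (p := fun q y => y.1 = d q) (fun _ _ => rfl) (by fun_prop)
    (fun q => measurable_fst (MeasurableSet.of_discrete (s := {d q})))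
    (fun n h σ hσ => by
      have hσ' : σ = d (History.last h) := by
        rwa [← PMF.mem_support_iff, stationary, PMF.mem_support_pure_iff] at hσ
      refine ae_of_ae_map (p := fun b => b = d (History.last h)) measurable_fst.aemeasurable ?_
      rw [Measure.map_fst_prod, hσ']
      simp [ae_dirac_eq]) _

section limits

variable {G : Set S} {k ε : ℝ} {x y : S → ℝ}

theorem ae_le_liminf_timeFraction (D : M.Policy) (s : S)
    (hf : M.mdp.LPFeasible (M.cost₁ G) M.cost₂ k x) (hε : 0 < ε)
    (hy : M.mdp.LPFeasible M.cost₂ (fun _ _ => 1) ε y) :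
    ∀ᵐ π ∂D.pathMeasure s,
      ENNReal.ofReal k ≤ liminf (fun t : ℝ => timeFraction G t π) atTop := by
  filter_upwards [D.ae_tendsto_sum_sub_expNext s x, D.ae_tendsto_sum_sub_expNext s y,
    D.ae_tendsto_sum_sojourn s 1, D.ae_tendsto_sum_sojourn s fun s => G.indicator 1 s - k]
    with π ⟨hen, hx⟩ ⟨_, hy'⟩ h1 hG
  simp only [Pi.one_apply, one_mul] at h1
  refine Path.ofReal_le_liminf_timeFraction hε (Path.avgNonneg_elapsed hen hy hy' h1)
    (Path.avgNonneg_neg_sojourn h1) ?_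
  simp only [Path.sum_sojourn_eq hen]
  exact (hf.avgNonneg (q := fun n => (π n).2.2) (b := fun n => (π (n + 1)).1)
    (fun n => by rw [mdp_enabled]; exact hen n) hx).add (avgNonneg_of_tendsto_zero hG)

theorem ae_tendsto_timeFraction_stationary {d : S → Option A} (hd : M.IsStationary d) (s : S)
    (hf : M.mdp.LPFeasible (M.cost₁ G) M.cost₂ k x)
    (hdx : ∀ s, x s = M.cost₁ G s (d s) - k * M.cost₂ s (d s) +
      ∑ s', (M.mdp.P s (d s) s' : ℝ) * x s')
    (hε : 0 < ε) (hy : M.mdp.LPFeasible M.cost₂ (fun _ _ => 1) ε y) :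
    ∀ᵐ π ∂(M.stationary d hd).pathMeasure s,
      Tendsto (fun t : ℝ => timeFraction G t π) atTop (𝓝 (ENNReal.ofReal k)) := by
  filter_upwards [(M.stationary d hd).ae_tendsto_sum_sub_expNext s x,
    (M.stationary d hd).ae_tendsto_sum_sub_expNext s y,
    (M.stationary d hd).ae_tendsto_sum_sojourn s 1,
    (M.stationary d hd).ae_tendsto_sum_sojourn s fun s => G.indicator 1 s - k,
    ae_stationary hd s, (M.stationary d hd).ae_le_liminf_timeFraction s hf hε hy]
    with π ⟨hen, hx⟩ ⟨_, hy'⟩ h1 hG hst hlow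
  simp only [Pi.one_apply, one_mul] at h1
  refine tendsto_of_le_liminf_of_limsup_le hlow (Path.limsup_timeFraction_le_ofReal hε
    (Path.avgNonneg_elapsed hen hy hy' h1) (Path.avgNonneg_neg_sojourn h1) ?_)
  refine ((MDP.avgNonneg_of_equation hdx (q := fun n => (π n).2.2)
    (b := fun n => (π (n + 1)).1) hst hx).add (avgNonneg_neg_of_tendsto_zero hG)).mono
    fun n => le_of_eq ?_
  linarith [Path.sum_sojourn_eq (G := G) (k := k) hen n]

end limits

end Policy

end MarkovAutomaton

/-! ### From almost sure bounds to expectations, and the theorem. -/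

section lintegral

variable {Ω ι : Type*} [MeasurableSpace Ω] {μ : Measure Ω} [IsProbabilityMeasure μ]
  {l : Filter ι} [l.NeBot] {f : ι → Ω → ℝ≥0∞} {K : ℝ≥0∞}

theorem le_lintegral_of_ae_le {g : Ω → ℝ≥0∞} (h : ∀ᵐ ω ∂μ, K ≤ g ω) : K ≤ ∫⁻ ω, g ω ∂μ := by
  simpa using lintegral_mono_ae h

theorem lintegral_eq_of_ae_eq {g : Ω → ℝ≥0∞} (h : ∀ᵐ ω ∂μ, g ω = K) : ∫⁻ ω, g ω ∂μ = K := by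
  simpa using lintegral_congr_ae h

theorem le_lintegral_limsup (h : ∀ᵐ ω ∂μ, K ≤ liminf (fun i => f i ω) l) :
    K ≤ ∫⁻ ω, limsup (fun i => f i ω) l ∂μ :=
  le_lintegral_of_ae_le (h.mono fun _ hω => hω.trans liminf_le_limsup)

/-- `limUnder` carries information only where the limit exists, hence the second hypothesis. -/
theorem le_lintegral_limUnder (h : ∀ᵐ ω ∂μ, K ≤ liminf (fun i => f i ω) l)
    (hlim : ∀ᵐ ω ∂μ, ∃ a, Tendsto (fun i => f i ω) l (𝓝 a)) :
    K ≤ ∫⁻ ω, limUnder l (fun i => f i ω) ∂μ := by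
  refine le_lintegral_of_ae_le ?_
  filter_upwards [h, hlim] with ω h1 ⟨a, ha⟩
  rwa [ha.limUnder_eq, ← ha.liminf_eq]

end lintegral

theorem theorem3 {S A : Type*} [Fintype S] [Fintype A]
    [MeasurableSpace S] [DiscreteMeasurableSpace S]
    (M : MarkovAutomaton S A) (hdet : M.ActionDeterministic) (hdead : M.DeadlockFree)
    (hzeno : M.NonZeno) (huni : M.Unichain) (G : Set S) (s : S) :
    M.LRAmin s G = M.mdp.Rmin (M.cost₁ G) M.cost₂ s ∧
    (M.LRAminInf s G = M.LRAmin s G ∧ M.LRAminSup s G = M.LRAmin s G ∧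
      M.mdp.RminInf (M.cost₁ G) M.cost₂ s = M.mdp.Rmin (M.cost₁ G) M.cost₂ s ∧
      M.mdp.RminSup (M.cost₁ G) M.cost₂ s = M.mdp.Rmin (M.cost₁ G) M.cost₂ s) ∧
    (∃ (d : S → Option A) (hd : M.IsStationary d) (hd' : M.mdp.IsStationary d),
      (M.stationary d hd).AverageExists s G ∧
      (M.stationary d hd).LRA s G = M.LRAmin s G ∧
      (M.mdp.stationary d hd').RatioExists (M.cost₁ G) M.cost₂ s ∧
      (M.mdp.stationary d hd').expRatio (M.cost₁ G) M.cost₂ s =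
        M.mdp.Rmin (M.cost₁ G) M.cost₂ s) ∧
    (M.LRAmin s G ≠ ⊤ ∧
      IsGreatest {k : ℝ | ∃ x : S → ℝ, M.mdp.LPFeasible (M.cost₁ G) M.cost₂ k x}
        (M.LRAmin s G).toReal) := by
  have hen : ∀ s, (M.mdp.enabled s).Nonempty := fun s => by
    rw [M.mdp_enabled]
    exact M.enabled_nonempty hdead s
  have hc : ∀ d, M.mdp.IsStationary d → ∃ s, 0 < M.cost₂ s (d s) := fun d hd =>
    M.exists_cost₂_pos hdead hzeno huni (M.mdp_isStationary.1 hd)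
  obtain ⟨ε, hε, y, hy⟩ := MDP.exists_pos_potential hen huni.mdp M.cost₂ hc
  obtain ⟨k, x, d, hd', hf, hdx, hmax⟩ :=
    MDP.exists_optimality_equation hen huni.mdp (M.cost₁ G) M.cost₂ hc
  have hd : M.IsStationary d := M.mdp_isStationary.1 hd'
  -- The point (0, 0) is feasible because `c₁` is nonnegative; so `k` survives the passage through
  -- `ENNReal.ofReal`.
  have hk : 0 ≤ k := hmax 0 0 fun q σ _ => by simp
  have lowLRA := fun D : M.Policy => D.ae_le_liminf_timeFraction s hf hε hy
  have lowR := fun D : M.mdp.Policy => D.ae_le_liminf_costRatio s hf hε hy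
  have limLRA := MarkovAutomaton.Policy.ae_tendsto_timeFraction_stationary hd s hf hdx hε hy
  have limR := MDP.Policy.ae_tendsto_costRatio_stationary hd' s hf hdx hε hy
  have : ∀ D : M.Policy, IsProbabilityMeasure (D.pathMeasure s) := fun D => by
    unfold MarkovAutomaton.Policy.pathMeasure
    infer_instance
  have : ∀ D : M.mdp.Policy, IsProbabilityMeasure (D.pathMeasure s) := fun D => by
    unfold MDP.Policy.pathMeasure
    infer_instance
  have exLRA : (M.stationary d hd).AverageExists s G := limLRA.mono fun _ h => ⟨_, h⟩
  have exR : (M.mdp.stationary d hd').RatioExists (M.cost₁ G) M.cost₂ s :=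
    limR.mono fun _ h => ⟨_, h⟩
  have dLRA : (M.stationary d hd).LRA s G = ENNReal.ofReal k :=
    lintegral_eq_of_ae_eq (limLRA.mono fun _ h => h.limUnder_eq)
  have dR : (M.mdp.stationary d hd').expRatio (M.cost₁ G) M.cost₂ s = ENNReal.ofReal k :=
    lintegral_eq_of_ae_eq (limR.mono fun _ h => h.limUnder_eq)
  -- In each of the six identities `d` gives the upper bound and the almost sure lower bound, valid
  -- for every policy, gives the other.
  have eLRA : M.LRAmin s G = ENNReal.ofReal k := le_antisymm
    (iInf₂_le_of_le _ exLRA dLRA.le)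
    (le_iInf₂ fun D hD => le_lintegral_limUnder (lowLRA D) hD)
  have eR : M.mdp.Rmin (M.cost₁ G) M.cost₂ s = ENNReal.ofReal k := le_antisymm
    (iInf₂_le_of_le _ exR dR.le)
    (le_iInf₂ fun D hD => le_lintegral_limUnder (lowR D) hD)
  have eLRAInf : M.LRAminInf s G = ENNReal.ofReal k := le_antisymm
    (iInf_le_of_le _ (lintegral_eq_of_ae_eq (limLRA.mono fun _ h => h.liminf_eq)).le)
    (le_iInf fun D => le_lintegral_of_ae_le (lowLRA D))
  have eLRASup : M.LRAminSup s G = ENNReal.ofReal k := le_antisymm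
    (iInf_le_of_le _ (lintegral_eq_of_ae_eq (limLRA.mono fun _ h => h.limsup_eq)).le)
    (le_iInf fun D => le_lintegral_limsup (lowLRA D))
  have eRInf : M.mdp.RminInf (M.cost₁ G) M.cost₂ s = ENNReal.ofReal k := le_antisymm
    (iInf_le_of_le _ (lintegral_eq_of_ae_eq (limR.mono fun _ h => h.liminf_eq)).le)
    (le_iInf fun D => le_lintegral_of_ae_le (lowR D))
  have eRSup : M.mdp.RminSup (M.cost₁ G) M.cost₂ s = ENNReal.ofReal k := le_antisymm
    (iInf_le_of_le _ (lintegral_eq_of_ae_eq (limR.mono fun _ h => h.limsup_eq)).le)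
    (le_iInf fun D => le_lintegral_limsup (lowR D))
  rw [eLRA, eR, eLRAInf, eLRASup, eRInf, eRSup, ENNReal.toReal_ofReal hk]
  exact ⟨rfl, ⟨rfl, rfl, rfl, rfl⟩, ⟨d, hd, hd', exLRA, dLRA, exR, dR⟩, ENNReal.ofReal_ne_top,
    ⟨x, hf⟩, fun k' ⟨x', hx'⟩ => hmax k' x' hx'⟩

end
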